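/- Let $\mathbb T$ be one of the theories $\mathit{List}$, $\mathit{MSet}$, $\mathit{CList}$, $\mathit{Set}$. Let $\mathcal F$ be a set of function symbols with arities containing a constant $\mathtt{nil}$, a binary aggregate constructor $[\,\cdot\mid\cdot\,]$, and arbitrarily many further constant and function symbols. A $\mathbb T$-constraint $C$ is a finite conjunction of literals $s=t$, $s\neq t$, $s\in t$, $s\notin t$, where $s,t$ are terms over $\mathcal F$ and a denumerable set of variables. The equational theory $E_{\mathbb T}$ is empty for $\mathit{List}$; consists of permutativity $[x,y\mid z]=[y,x\mid z]$ for $\mathit{MSet}$; of absorption $[x,x\mid y]=[x\mid y]$ for $\mathit{CList}$; and of both for $\mathit{Set}$. The privileged model $\mathcal A_{\mathbb T}$ (namely $\mathcal{LIST}$, $\mathcal{MSET}$, $\mathcal{CLIST}$, $\mathcal{SET}$, respectively) has as domain the set of ground terms over $\mathcal F$ modulo the smallest congruence $\equiv_{\mathbb T}$ induced by $E_{\mathbb T}$; function symbols are interpreted by term formation, $=$ by identity, and the class of $t$ is a member of the class of $s$ if and only if the latter contains a term of the form $[t_1,\dots,t_n,t\mid r]$ with $n\ge 0$. Then, for each of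 the four theories $\mathbb T$, it is decidable, given a $\mathbb T$-constraint $C$, whether $\mathcal A_{\mathbb T}\models\exists\, C$, that is, whether some valuation of the variables in $\mathcal A_{\mathbb T}$ makes all the literals of $C$ true. More precisely, there is an algorithm, depending only on $\mathbb T$ and not on $\mathcal F$, which decides this from the written form of $C$, in which every further symbol is represented by its arity and a natural number, distinct symbols of the same arity occurring in $C$ being represented by distinct numbers. -/

import Mathlib

universe u

namespace Aggregates



/-- The four kinds of aggregates (and the corresponding theories). -/
inductive Kind where
  | list
  | mset
  | clist
  | set

/-- The equational theory of the aggregate contains permutativity `[x, y | z] = [y, x | z]`. -/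
def Kind.Permutative : Kind → Prop
  | .list => False
  | .mset => True
  | .clist => False
  | .set => True

/-- The equational theory of the aggregate contains absorption `[x, x | y] = [x | y]`. -/
def Kind.Absorptive : Kind → Prop
  | .list => False
  | .mset => False
  | .clist => True
  | .set => True

/-- Function symbols by arity: the constant `nil`, the binary aggregate constructor `cons`, and
arbitrary further symbols, those of arity `n` being the elements of `F n`. -/
inductive Fun (F : ℕ → Type u) : ℕ → Type u where
  | nil : Fun F 0
  | cons : Fun F 2
  | other {n : ℕ} (f : F n) : Fun F n

/-- The only predicate symbol besides equality: binary membership. -/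
inductive Pred : ℕ → Type where
  | mem : Pred 2

/-- The first-order language with function symbols `Fun F` and predicates `=` and membership. -/
def lang (F : ℕ → Type u) : FirstOrder.Language.{u, 0} := ⟨Fun F, Pred⟩

/-- Terms with variables in `α`; ground terms are `Tm F Empty`. -/
abbrev Tm (F : ℕ → Type u) (α : Type) : Type u := (lang F).Term α

/-- The term `[s | t]`. -/
def consT {F : ℕ → Type u} {α : Type} (s t : Tm F α) : Tm F α :=
  FirstOrder.Language.Term.func (L := lang F) (Fun.cons : Fun F 2) ![s, t]

/-- The smallest congruence on ground terms that contains all ground instances of the equational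
axioms of the theory. -/
inductive Cong (T : Kind) {F : ℕ → Type u} : Tm F Empty → Tm F Empty → Prop where
  | refl (s : Tm F Empty) : Cong T s s
  | symm {s t : Tm F Empty} : Cong T s t → Cong T t s
  | trans {r s t : Tm F Empty} : Cong T r s → Cong T s t → Cong T r t
  | func {n : ℕ} (f : Fun F n) (ss ts : Fin n → Tm F Empty) : (∀ i, Cong T (ss i) (ts i)) →
      Cong T (FirstOrder.Language.Term.func (L := lang F) f ss) (FirstOrder.Language.Term.func (L := lang F) f ts)
  | perm (h : T.Permutative) (x y z : Tm F Empty) :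
      Cong T (consT x (consT y z)) (consT y (consT x z))
  | absorb (h : T.Absorptive) (x y : Tm F Empty) :
      Cong T (consT x (consT x y)) (consT x y)

def congSetoid (T : Kind) (F : ℕ → Type u) : Setoid (Tm F Empty) :=
  ⟨Cong T, Cong.refl, Cong.symm, Cong.trans⟩

/-- The domain of the privileged model: ground terms modulo the congruence. -/
def Model (T : Kind) (F : ℕ → Type u) : Type u := Quotient (congSetoid T F)

/-- The class of a ground term. -/
def Model.mk (T : Kind) {F : ℕ → Type u} (t : Tm F Empty) : Model T F :=
  Quotient.mk (congSetoid T F) t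

/-- Membership in the privileged model: the class `b` contains a term `[t₁, …, tₙ, t | r]`
(`n ≥ 0`) such that `a` is the class of `t`. -/
def Model.Mem {T : Kind} {F : ℕ → Type u} (a b : Model T F) : Prop :=
  ∃ (ts : List (Tm F Empty)) (t r : Tm F Empty),
    Model.mk T t = a ∧ Model.mk T (ts.foldr consT (consT t r)) = b

/-- The privileged model as a first-order structure: a function symbol acts on classes through
representatives. -/
noncomputable instance Model.structure (T : Kind) (F : ℕ → Type u) :
    (lang F).Structure (Model T F) where
  funMap := fun {_} f xs => Model.mk T
    (FirstOrder.Language.Term.func (L := lang F) f (fun i => Quotient.out (s := congSetoid T F) (xs i)))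
  RelMap := fun {_} R =>
    match R with
    | Pred.mem => fun xs => Model.Mem (xs 0) (xs 1)

/-- The interpretation of a function symbol does not depend on the representatives. -/
theorem Model.funMap_mk (T : Kind) {F : ℕ → Type u} {n : ℕ} (f : Fun F n)
    (ts : Fin n → Tm F Empty) :
    FirstOrder.Language.Structure.funMap (L := lang F) (M := Model T F) f (fun i => Model.mk T (ts i)) =
      Model.mk T (FirstOrder.Language.Term.func (L := lang F) f ts) :=
  Quotient.sound (s := congSetoid T F)
    (Cong.func f _ _ fun i => Quotient.mk_out (s := congSetoid T F) (ts i))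

/-- The literals `s = t`, `s ≠ t`, `s ∈ t`, `s ∉ t` over terms with variables in `ℕ`. -/
inductive Literal (F : ℕ → Type u) : Type u where
  | eq (s t : Tm F ℕ)
  | ne (s t : Tm F ℕ)
  | mem (s t : Tm F ℕ)
  | nmem (s t : Tm F ℕ)

/-- The membership atom `s ∈ t`. -/
def memFormula {F : ℕ → Type u} (s t : Tm F ℕ) : (lang F).Formula ℕ :=
  FirstOrder.Language.Relations.formula₂ (L := lang F) (Pred.mem : Pred 2) s t

/-- The first-order formula that a literal stands for. -/
def Literal.toFormula {F : ℕ → Type u} : Literal F → (lang F).Formula ℕ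
  | .eq s t => FirstOrder.Language.Term.equal s t
  | .ne s t => FirstOrder.Language.BoundedFormula.not (FirstOrder.Language.Term.equal s t)
  | .mem s t => memFormula s t
  | .nmem s t => FirstOrder.Language.BoundedFormula.not (memFormula s t)

/-- A constraint: the conjunction of a finite list of literals. -/
abbrev Constraint (F : ℕ → Type u) : Type u := List (Literal F)

/-- Some valuation in the privileged model makes all literals of the constraint true. -/
def Constraint.Satisfiable (T : Kind) {F : ℕ → Type u} (C : Constraint F) : Prop :=
  ∃ σ : ℕ → Model T F, ∀ l ∈ C, l.toFormula.Realize σ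

/-! The further function symbols that occur in a constraint, with their arities. -/

def Fun.others {F : ℕ → Type u} : {n : ℕ} → Fun F n → Set (Σ n, F n)
  | _, .nil => ∅
  | _, .cons => ∅
  | n, .other f => {⟨n, f⟩}

def termSymbols {F : ℕ → Type u} : Tm F ℕ → Set (Σ n, F n)
  | .var _ => ∅
  | .func f ts => Fun.others f ∪ ⋃ i, termSymbols (ts i)

def Literal.symbols {F : ℕ → Type u} : Literal F → Set (Σ n, F n)
  | .eq s t => termSymbols s ∪ termSymbols t
  | .ne s t => termSymbols s ∪ termSymbols t
  | .mem s t => termSymbols s ∪ termSymbols t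
  | .nmem s t => termSymbols s ∪ termSymbols t

def Constraint.symbols {F : ℕ → Type u} (C : Constraint F) : Set (Σ n, F n) :=
  ⋃ l ∈ C, l.symbols

/-! The Gödel numbering of the syntax, where the further symbol `f` of arity `n` is written as the
pair of `n` and the number `ν n f`. -/

def Fun.code {F : ℕ → Type u} (ν : ∀ n, F n → ℕ) : {n : ℕ} → Fun F n → ℕ
  | _, .nil => Nat.pair 0 0
  | _, .cons => Nat.pair 1 0
  | n, .other f => Nat.pair 2 (Nat.pair n (ν n f))

def termCode {F : ℕ → Type u} (ν : ∀ n, F n → ℕ) : Tm F ℕ → ℕ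
  | .var i => Nat.pair 0 i
  | .func f ts => Nat.pair 1
      (Nat.pair (Fun.code ν f) (Encodable.encode (List.ofFn fun i => termCode ν (ts i))))

def Literal.code {F : ℕ → Type u} (ν : ∀ n, F n → ℕ) : Literal F → ℕ
  | .eq s t => Nat.pair 0 (Nat.pair (termCode ν s) (termCode ν t))
  | .ne s t => Nat.pair 1 (Nat.pair (termCode ν s) (termCode ν t))
  | .mem s t => Nat.pair 2 (Nat.pair (termCode ν s) (termCode ν t))
  | .nmem s t => Nat.pair 3 (Nat.pair (termCode ν s) (termCode ν t))

def Constraint.code {F : ℕ → Type u} (ν : ∀ n, F n → ℕ) (C : Constraint F) : List ℕ :=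
  List.map (Literal.code ν) C

/-- `ν` gives different numbers to different further symbols of equal arity that occur in `C`
(so that `C.code ν` is a faithful written form of `C`). -/
def Constraint.Naming {F : ℕ → Type u} (ν : ∀ n, F n → ℕ) (C : Constraint F) : Prop :=
  ∀ n, Set.InjOn (ν n) {f : F n | (⟨n, f⟩ : Σ n, F n) ∈ C.symbols}

end Aggregates

/-! A solution of a constraint matters only through the values of the finitely many subterms, and
these matter only through a finite pattern: which subterms have equal values, a rank that orders the
values along their construction, and which values are elements of which. Patterns read off from
solutions obey finitely many local conditions. Conversely, every pattern obeying them is realised in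
the privileged model. The size of a pattern is bounded in terms of the code of the constraint, so
satisfiability becomes a bounded search over numbers, which is primitive recursive. Further symbols
enter only through equality of their numbers, and the auxiliary elements are built from `nil` and
`cons` alone; hence the procedure does not depend on `F`.

To realise a pattern, values are defined by recursion on the rank. Where the term structure leaves a
value open, a marker `Model.fresh N κ` of depth `N + 2` is inserted. Values have depth at most `N`
or at least `N + 3`, so a marker is never the value of a subterm: it adds no membership between
values, yet keeps different classes apart.

With permutativity, an aggregate is determined by its kernel and its multiplicities
(`Model.ext_cnt`). The values of `[s | t]` and `t` have the same kernel and differ only in the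
multiplicity of one value, which is why patterns record components of linked terms. Multiplicities
are unbounded, but only zero, one, successors and coincidences matter, and these survive compression
(`exists_compress`). The two directions are `CommPattern.sound` and `CommPattern.complete`.

Without permutativity, an aggregate is determined by its kernel and its list of elements, immediate
repetitions being merged under absorption (`Model.ext_elts`). Here the pattern must say when `[a |
b]` collapses to `b`, that is, when `b` begins with `a`. The two directions are `ChainPattern.sound`
and `ChainPattern.complete`.

The passage from constraints to numbers is `exists_interp_satisfiable_iff`; `exists_table` packs a
pattern into one number. -/

namespace Aggregates

/-! ### Recursion on ground terms modulo the congruence. -/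

section ModelAPI

variable {T : Kind} {F : ℕ → Type u}

/-- The symbol is the aggregate constructor. -/
def Fun.IsCons {F : ℕ → Type u} : {n : ℕ} → Fun F n → Prop
  | _, .nil => False
  | _, .cons => True
  | _, .other _ => False

/-- The interpretation of a function symbol in the privileged model. -/
noncomputable def Model.app {n : ℕ} (f : Fun F n) (xs : Fin n → Model T F) : Model T F :=
  FirstOrder.Language.Structure.funMap (L := lang F) (M := Model T F) f xs

/-- The aggregate `[a | b]` in the privileged model. -/
noncomputable def Model.cons (a b : Model T F) : Model T F :=
  Model.app Fun.cons ![a, b]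

/-- The class of `nil`. -/
noncomputable def Model.nil : Model T F := Model.app Fun.nil ![]

theorem Model.exists_mk (x : Model T F) : ∃ t, Model.mk T t = x := Quotient.exists_rep x

theorem Model.mk_eq_iff {s t : Tm F Empty} : Model.mk T s = Model.mk T t ↔ Cong T s t :=
  ⟨fun h => Quotient.exact (s := congSetoid T F) h, fun h => Quotient.sound (s := congSetoid T F) h⟩

theorem Model.app_mk {n : ℕ} (f : Fun F n) (ts : Fin n → Tm F Empty) :
    Model.app f (fun i => Model.mk T (ts i)) =
      Model.mk T (FirstOrder.Language.Term.func (L := lang F) f ts) :=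
  Model.funMap_mk T f ts

theorem Model.cons_mk (s t : Tm F Empty) :
    Model.cons (Model.mk T s) (Model.mk T t) = Model.mk T (consT s t) := by
  have h := Model.app_mk (T := T) (Fun.cons : Fun F 2) ![s, t]
  rw [consT, ← h, Model.cons]
  congr 1
  funext i
  fin_cases i <;> rfl

theorem Model.app_cons (xs : Fin 2 → Model T F) :
    Model.app Fun.cons xs = Model.cons (xs 0) (xs 1) := by
  rw [Model.cons]
  congr 1
  funext i
  fin_cases i <;> rfl

theorem Model.cons_comm (h : T.Permutative) (x y z : Model T F) :
    Model.cons x (Model.cons y z) = Model.cons y (Model.cons x z) := by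
  obtain ⟨x, rfl⟩ := x.exists_mk
  obtain ⟨y, rfl⟩ := y.exists_mk
  obtain ⟨z, rfl⟩ := z.exists_mk
  simp only [Model.cons_mk, Model.mk_eq_iff]
  exact Cong.perm h x y z

theorem Model.cons_absorb (h : T.Absorptive) (x y : Model T F) :
    Model.cons x (Model.cons x y) = Model.cons x y := by
  obtain ⟨x, rfl⟩ := x.exists_mk
  obtain ⟨y, rfl⟩ := y.exists_mk
  simp only [Model.cons_mk, Model.mk_eq_iff]
  exact Cong.absorb h x y

@[elab_as_elim]
theorem Model.ind {p : Model T F → Prop}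
    (happ : ∀ (n : ℕ) (f : Fun F n) (xs : Fin n → Model T F), ¬ f.IsCons → (∀ i, p (xs i)) →
      p (Model.app f xs))
    (hcons : ∀ a b, p a → p b → p (Model.cons a b)) (x : Model T F) : p x := by
  obtain ⟨t, rfl⟩ := x.exists_mk
  induction t with
  | var x => exact x.elim
  | @func n f ts ih =>
    refine (Model.app_mk (T := T) (n := n) f ts).subst (motive := p) ?_
    cases (show Fun F n from f) with
    | nil => exact happ _ _ _ (fun h => h) fun i => i.elim0
    | cons =>
      rw [Model.app_cons]
      exact hcons _ _ (ih 0) (ih 1)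
    | other f => exact happ _ _ _ (fun h => h) ih

/-- One step of the recursion on the privileged model. -/
def recStep {β : Type*} (app : ∀ {n : ℕ}, Fun F n → (Fin n → Model T F) → (Fin n → β) → β)
    (cns : Model T F → Model T F → β → β → β) :
    {n : ℕ} → Fun F n → (Fin n → Model T F) → (Fin n → β) → β
  | _, .nil, xs, bs => app .nil xs bs
  | _, .cons, xs, bs => cns (xs 0) (xs 1) (bs 0) (bs 1)
  | _, .other f, xs, bs => app (.other f) xs bs

theorem recStep_of_not_isCons {β : Type*}
    (app : ∀ {n : ℕ}, Fun F n → (Fin n → Model T F) → (Fin n → β) → β)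
    (cns : Model T F → Model T F → β → β → β) {n : ℕ} (f : Fun F n) (hf : ¬ f.IsCons)
    (xs : Fin n → Model T F) (bs : Fin n → β) : recStep app cns f xs bs = app f xs bs := by
  cases f with
  | nil => rfl
  | cons => exact (hf trivial).elim
  | other f => rfl

/-- Recursion on ground terms that also has access to the classes of the subterms. -/
def recTm {β : Type*} (step : ∀ {n : ℕ}, Fun F n → (Fin n → Model T F) → (Fin n → β) → β) :
    Tm F Empty → β
  | .var x => x.elim
  | .func f ts => step f (fun i => Model.mk T (ts i)) (fun i => recTm step (ts i))

/-- The recursion principle of the privileged model. -/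
theorem Model.exists_rec {β : Type*}
    (app : ∀ {n : ℕ}, Fun F n → (Fin n → Model T F) → (Fin n → β) → β)
    (cns : Model T F → Model T F → β → β → β)
    (hperm : T.Permutative → ∀ x y z a b c,
      cns x (Model.cons y z) a (cns y z b c) = cns y (Model.cons x z) b (cns x z a c))
    (habsorb : T.Absorptive → ∀ x y a b,
      cns x (Model.cons x y) a (cns x y a b) = cns x y a b) :
    ∃ φ : Model T F → β,
      (∀ (n : ℕ) (f : Fun F n) (xs : Fin n → Model T F), ¬ f.IsCons →
        φ (Model.app f xs) = app f xs (fun i => φ (xs i))) ∧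
      ∀ a b, φ (Model.cons a b) = cns a b (φ a) (φ b) := by
  have hc : ∀ s t : Tm F Empty, recTm (T := T) (recStep app cns) (consT s t) =
      cns (Model.mk T s) (Model.mk T t) (recTm (T := T) (recStep app cns) s)
        (recTm (T := T) (recStep app cns) t) := fun s t => rfl
  -- The two hypotheses cover the two axioms. The congruence rule is harmless because a step sees
  -- its subterms only through their classes and their results.
  have key : ∀ s t : Tm F Empty, Cong T s t →
      recTm (T := T) (recStep app cns) s = recTm (T := T) (recStep app cns) t := by
    intro s t h
    induction h with
    | refl s => rfl
    | symm _ ih => exact ih.symm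
    | trans _ _ ih₁ ih₂ => exact ih₁.trans ih₂
    | func f ss ts h ih =>
      simp only [recTm]
      congr 1
      · funext i
        exact Model.mk_eq_iff.2 (h i)
      · funext i
        exact ih i
    | perm h x y z =>
      simp only [hc, ← Model.cons_mk]
      exact hperm h _ _ _ _ _ _
    | absorb h x y =>
      simp only [hc, ← Model.cons_mk]
      exact habsorb h _ _ _ _
  refine ⟨Quotient.lift (s := congSetoid T F) (recTm (T := T) (recStep app cns)) key, ?_, ?_⟩
  · intro n f xs hf
    choose ts hts using fun i => (xs i).exists_mk
    obtain rfl : (fun i => Model.mk T (ts i)) = xs := funext hts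
    rw [Model.app_mk]
    exact recStep_of_not_isCons app cns f hf _ _
  · intro a b
    obtain ⟨a, rfl⟩ := a.exists_mk
    obtain ⟨b, rfl⟩ := b.exists_mk
    rw [Model.cons_mk]
    rfl

/-! Invariants of the elements of the privileged model. -/

/-- Both axioms relate aggregates only, so the outermost symbol and the arguments of any other term
are functions of its class. This gives freeness of all symbols except `cons`. -/
theorem Model.exists_view (T : Kind) (F : ℕ → Type u) :
    ∃ φ : Model T F → Option (Σ n, Fun F n × (Fin n → Model T F)),
      (∀ (n : ℕ) (f : Fun F n) (xs : Fin n → Model T F), ¬ f.IsCons →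
        φ (Model.app f xs) = some ⟨n, f, xs⟩) ∧ ∀ a b, φ (Model.cons a b) = none :=
  Model.exists_rec (β := Option (Σ n, Fun F n × (Fin n → Model T F)))
    (fun {n} f xs _ => some ⟨n, f, xs⟩) (fun _ _ _ _ => none)
    (fun _ _ _ _ _ _ _ => rfl) (fun _ _ _ _ _ => rfl)

theorem Model.app_inj {n m : ℕ} {f : Fun F n} {g : Fun F m} {xs : Fin n → Model T F}
    {ys : Fin m → Model T F} (hf : ¬ f.IsCons) (hg : ¬ g.IsCons)
    (h : Model.app f xs = Model.app g ys) :
    (⟨n, f, xs⟩ : Σ n, Fun F n × (Fin n → Model T F)) = ⟨m, g, ys⟩ := by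
  obtain ⟨φ, h₁, -⟩ := Model.exists_view T F
  have := congrArg φ h
  rwa [h₁ _ _ _ hf, h₁ _ _ _ hg, Option.some_inj] at this

theorem Model.app_ne_cons {n : ℕ} {f : Fun F n} {xs : Fin n → Model T F} (hf : ¬ f.IsCons)
    (a b : Model T F) : Model.app f xs ≠ Model.cons a b := by
  obtain ⟨φ, h₁, h₂⟩ := Model.exists_view T F
  intro h
  have := congrArg φ h
  rw [h₁ _ _ _ hf, h₂] at this
  cases this

theorem Model.exists_ker (T : Kind) (F : ℕ → Type u) :
    ∃ φ : Model T F → Model T F,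
      (∀ (n : ℕ) (f : Fun F n) (xs : Fin n → Model T F), ¬ f.IsCons →
        φ (Model.app f xs) = Model.app f xs) ∧ ∀ a b, φ (Model.cons a b) = φ b :=
  Model.exists_rec (fun f xs _ => Model.app f xs) (fun _ _ _ b => b)
    (fun _ _ _ _ _ _ _ => rfl) (fun _ _ _ _ _ => rfl)

/-- The kernel of an aggregate: what is left when all elements are removed. -/
noncomputable def Model.ker (x : Model T F) : Model T F := (Model.exists_ker T F).choose x

theorem Model.ker_app {n : ℕ} {f : Fun F n} {xs : Fin n → Model T F} (hf : ¬ f.IsCons) :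
    (Model.app f xs).ker = Model.app f xs := (Model.exists_ker T F).choose_spec.1 n f xs hf

@[simp]
theorem Model.ker_cons (a b : Model T F) : (Model.cons a b).ker = b.ker :=
  (Model.exists_ker T F).choose_spec.2 a b

/-- The rest `b` of `[a | b]` does not count as nested. This makes the depth invariant under
permutation and absorption, while elements of aggregates and arguments of other symbols still have
smaller depth. -/
theorem Model.exists_dep (T : Kind) (F : ℕ → Type u) :
    ∃ φ : Model T F → ℕ,
      (∀ (n : ℕ) (f : Fun F n) (xs : Fin n → Model T F), ¬ f.IsCons →
        φ (Model.app f xs) = (Finset.univ.sup fun i => φ (xs i)) + 1) ∧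
      ∀ a b, φ (Model.cons a b) = max (φ a + 1) (φ b) :=
  Model.exists_rec (fun _ _ bs => (Finset.univ.sup bs) + 1) (fun _ _ a b => max (a + 1) b)
    (fun _ _ _ _ _ _ _ => max_left_comm _ _ _) (fun _ _ _ _ _ => by simp)

/-- The nesting depth. -/
noncomputable def Model.dep (x : Model T F) : ℕ := (Model.exists_dep T F).choose x

theorem Model.dep_app {n : ℕ} {f : Fun F n} {xs : Fin n → Model T F} (hf : ¬ f.IsCons) :
    (Model.app f xs).dep = (Finset.univ.sup fun i => (xs i).dep) + 1 :=
  (Model.exists_dep T F).choose_spec.1 n f xs hf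

@[simp]
theorem Model.dep_cons (a b : Model T F) : (Model.cons a b).dep = max (a.dep + 1) b.dep :=
  (Model.exists_dep T F).choose_spec.2 a b

theorem Model.exists_mem (y : Model T F) :
    ∃ φ : Model T F → Prop,
      (∀ (n : ℕ) (f : Fun F n) (xs : Fin n → Model T F), ¬ f.IsCons →
        φ (Model.app f xs) = False) ∧
      ∀ a b, φ (Model.cons a b) = (y = a ∨ φ b) :=
  Model.exists_rec (fun _ _ _ => False) (fun a _ _ p => y = a ∨ p)
    (fun _ _ _ _ _ _ _ => by simp only [eq_iff_iff]; tauto)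
    (fun _ _ _ _ _ => by simp only [eq_iff_iff]; tauto)

theorem Model.mk_foldr (ts : List (Tm F Empty)) (r : Tm F Empty) :
    Model.mk T (ts.foldr consT r) = (ts.map (Model.mk T)).foldr Model.cons (Model.mk T r) := by
  induction ts with
  | nil => rfl
  | cons t ts ih => simp [← Model.cons_mk, ih]

theorem Model.mem_iff_foldr {a b : Model T F} :
    Model.Mem a b ↔ ∃ (l : List (Model T F)) (r : Model T F),
      l.foldr Model.cons (Model.cons a r) = b := by
  constructor
  · rintro ⟨ts, t, r, rfl, rfl⟩
    exact ⟨ts.map (Model.mk T), Model.mk T r, by rw [Model.mk_foldr, Model.cons_mk]⟩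
  · rintro ⟨l, r, rfl⟩
    obtain ⟨t, rfl⟩ := a.exists_mk
    obtain ⟨r, rfl⟩ := r.exists_mk
    choose g hg using Model.exists_mk (T := T) (F := F)
    refine ⟨l.map g, t, r, rfl, ?_⟩
    rw [Model.mk_foldr, Model.cons_mk, List.map_map]
    congr 1
    simp [Function.comp_def, hg]

/-- Membership is defined through some representative of the class. The recursive predicate of
`Model.exists_mem` lives on classes, and agreement with it shows that changing the representative
brings in no new elements. -/
theorem Model.mem_app_cons_aux (y : Model T F) :
    (∀ (n : ℕ) (f : Fun F n) (xs : Fin n → Model T F), ¬ f.IsCons →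
        ¬ Model.Mem y (Model.app f xs)) ∧
      ∀ a b, Model.Mem y (Model.cons a b) ↔ y = a ∨ Model.Mem y b := by
  obtain ⟨φ, h₁, h₂⟩ := Model.exists_mem y
  have key : ∀ x, Model.Mem y x ↔ φ x := by
    intro x
    constructor
    · rw [Model.mem_iff_foldr]
      rintro ⟨l, r, rfl⟩
      induction l with
      | nil => simp [h₂]
      | cons a l ih => simp [h₂, ih]
    · induction x using Model.ind with
      | happ n f xs hf _ => simp [h₁ n f xs hf]
      | hcons a b _ ihb =>
        rw [h₂, Model.mem_iff_foldr]
        rintro (rfl | h)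
        · exact ⟨[], b, rfl⟩
        · obtain ⟨l, r, rfl⟩ := Model.mem_iff_foldr.1 (ihb h)
          exact ⟨a :: l, r, rfl⟩
  refine ⟨fun n f xs hf => ?_, fun a b => ?_⟩
  · rw [key, h₁ n f xs hf]
    exact id
  · rw [key, key, h₂]

theorem Model.not_mem_app {n : ℕ} {f : Fun F n} {xs : Fin n → Model T F} (hf : ¬ f.IsCons)
    (y : Model T F) : ¬ Model.Mem y (Model.app f xs) := (Model.mem_app_cons_aux y).1 n f xs hf

@[simp]
theorem Model.mem_cons {y a b : Model T F} :
    Model.Mem y (Model.cons a b) ↔ y = a ∨ Model.Mem y b := (Model.mem_app_cons_aux y).2 a b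

theorem Model.mem_foldr {y k : Model T F} {l : List (Model T F)} :
    Model.Mem y (l.foldr Model.cons k) ↔ y ∈ l ∨ Model.Mem y k := by
  induction l with
  | nil => simp
  | cons a l ih => simp [ih, or_assoc]

theorem Model.ker_foldr (k : Model T F) (l : List (Model T F)) :
    (l.foldr Model.cons k).ker = k.ker := by
  induction l with
  | nil => rfl
  | cons a l ih => simp [ih]

theorem Model.dep_lt_of_mem {y x : Model T F} (h : Model.Mem y x) : y.dep < x.dep := by
  induction x using Model.ind with
  | happ n f xs hf _ => exact (Model.not_mem_app hf y h).elim
  | hcons a b _ ihb =>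
    rw [Model.dep_cons]
    rcases Model.mem_cons.1 h with rfl | h
    · omega
    · have := ihb h
      omega

theorem Model.dep_ker_le (x : Model T F) : x.ker.dep ≤ x.dep := by
  induction x using Model.ind with
  | happ n f xs hf _ => rw [Model.ker_app hf]
  | hcons a b _ ihb => simp [ihb]

theorem Model.dep_foldr_le {k : Model T F} {l : List (Model T F)} {m : ℕ} (hk : k.dep ≤ m)
    (hl : ∀ a ∈ l, a.dep < m) : (l.foldr Model.cons k).dep ≤ m := by
  induction l with
  | nil => exact hk
  | cons a l ih =>
    simp only [List.foldr_cons, Model.dep_cons]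
    have := hl a (by simp)
    have := ih fun b hb => hl b (by simp [hb])
    omega

theorem Model.dep_le_foldr (k : Model T F) (l : List (Model T F)) :
    k.dep ≤ (l.foldr Model.cons k).dep := by
  induction l with
  | nil => exact le_rfl
  | cons a l ih => simp [ih]

theorem Fun.not_isCons_nil : ¬ (Fun.nil : Fun F 0).IsCons := fun h => h

@[simp]
theorem Model.dep_nil : (Model.nil : Model T F).dep = 1 := by
  rw [Model.nil, Model.dep_app Fun.not_isCons_nil]
  simp

@[simp]
theorem Model.not_mem_nil (y : Model T F) : ¬ Model.Mem y Model.nil :=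
  Model.not_mem_app Fun.not_isCons_nil y

/-! Many different elements of a given depth. -/

/-- Nested singletons. -/
noncomputable def Model.nest : ℕ → Model T F
  | 0 => Model.nil
  | k + 1 => Model.cons (Model.nest k) Model.nil

theorem Model.dep_nest (k : ℕ) : (Model.nest k : Model T F).dep = k + 1 := by
  induction k with
  | zero => simp [Model.nest]
  | succ k ih => simp [Model.nest, ih]

/-- For `i < K` these elements are pairwise different and have depth `K + 2`. -/
noncomputable def Model.fresh (K i : ℕ) : Model T F :=
  Model.cons (Model.nest i) (Model.cons (Model.nest K) Model.nil)

theorem Model.dep_fresh {K i : ℕ} (h : i < K) : (Model.fresh K i : Model T F).dep = K + 2 := by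
  simp [Model.fresh, Model.dep_nest]
  omega

/-- Nested singletons are told apart by their depth, and `i < K` prevents `nest i` from being the
common element `nest K`. -/
theorem Model.fresh_inj {K i j : ℕ} (hi : i < K)
    (h : (Model.fresh K i : Model T F) = Model.fresh K j) : i = j := by
  have h₁ : Model.Mem (Model.nest i : Model T F) (Model.fresh K j) := by
    rw [← h, Model.fresh]
    simp
  simp only [Model.fresh, Model.mem_cons, Model.not_mem_nil, or_false] at h₁
  rcases h₁ with h₁ | h₁ <;> have := congrArg Model.dep h₁ <;>
    simp only [Model.dep_nest] at this <;> omega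

/-! Elements and multiplicities. -/

-- Under absorption the stored list has no immediate repetitions: a new head equal to the present
-- one is dropped. Without permutativity no further identification has to be respected.
open Classical in
theorem Model.exists_elts (T : Kind) (F : ℕ → Type u) (hT : ¬ T.Permutative) :
    ∃ φ : Model T F → List (Model T F),
      (∀ (n : ℕ) (f : Fun F n) (xs : Fin n → Model T F), ¬ f.IsCons →
        φ (Model.app f xs) = []) ∧
      ∀ a b, φ (Model.cons a b) =
        if T.Absorptive ∧ (φ b).head? = some a then φ b else a :: φ b :=
  Model.exists_rec (fun _ _ _ => [])
    (fun a _ _ l => if T.Absorptive ∧ l.head? = some a then l else a :: l)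
    (fun h => (hT h).elim) (fun h x y a b => by split_ifs <;> simp_all)

open Classical in
/-- The list of elements of an aggregate, for the list-like theories. -/
noncomputable def Model.elts (x : Model T F) : List (Model T F) :=
  if h : T.Permutative then [] else (Model.exists_elts T F h).choose x

theorem Model.elts_app {n : ℕ} {f : Fun F n} {xs : Fin n → Model T F} (hf : ¬ f.IsCons) :
    (Model.app f xs).elts = [] := by
  unfold Model.elts
  split_ifs with h
  · rfl
  · exact (Model.exists_elts T F h).choose_spec.1 n f xs hf

open Classical in
theorem Model.elts_cons (hT : ¬ T.Permutative) (a b : Model T F) :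
    (Model.cons a b).elts =
      if T.Absorptive ∧ b.elts.head? = some a then b.elts else a :: b.elts := by
  unfold Model.elts
  simp only [hT, dite_false]
  exact (Model.exists_elts T F hT).choose_spec.2 a b

theorem Model.mem_elts (hT : ¬ T.Permutative) {y x : Model T F} :
    y ∈ x.elts ↔ Model.Mem y x := by
  induction x using Model.ind with
  | happ n f xs hf _ => simp [Model.elts_app hf, Model.not_mem_app hf]
  | hcons a b _ ihb =>
    rw [Model.elts_cons hT, Model.mem_cons]
    split_ifs with h
    · rw [ihb]
      constructor
      · exact Or.inr
      · rintro (rfl | h')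
        · exact ihb.1 (List.mem_of_head? h.2)
        · exact h'
    · simp [ihb]

theorem Model.foldr_elts (hT : ¬ T.Permutative) (x : Model T F) :
    x.elts.foldr Model.cons x.ker = x := by
  induction x using Model.ind with
  | happ n f xs hf _ => simp [Model.elts_app hf, Model.ker_app hf]
  | hcons a b _ ihb =>
    rw [Model.elts_cons hT, Model.ker_cons]
    split_ifs with h
    · obtain ⟨ha, h⟩ := h
      rw [List.head?_eq_some_iff] at h
      obtain ⟨l, hl⟩ := h
      rw [ihb]
      conv_lhs => rw [← ihb, hl]
      conv_rhs => rw [← ihb, hl]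
      simp only [List.foldr_cons]
      rw [Model.cons_absorb ha]
    · simp [ihb]

theorem Model.ext_elts (hT : ¬ T.Permutative) {x y : Model T F} (h₁ : x.elts = y.elts)
    (h₂ : x.ker = y.ker) : x = y := by
  rw [← Model.foldr_elts hT x, ← Model.foldr_elts hT y, h₁, h₂]

open Classical in
theorem Model.exists_cnt (y : Model T F) :
    ∃ φ : Model T F → ℕ,
      (∀ (n : ℕ) (f : Fun F n) (xs : Fin n → Model T F), ¬ f.IsCons →
        φ (Model.app f xs) = 0) ∧
      ∀ a b, φ (Model.cons a b) = if y = a then (if T.Absorptive then 1 else φ b + 1) else φ b :=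
  Model.exists_rec (fun _ _ _ => 0)
    (fun a _ _ m => if y = a then (if T.Absorptive then 1 else m + 1) else m)
    (fun _ _ _ _ _ _ _ => by split_ifs <;> rfl) (fun _ x _ _ _ => by split_ifs <;> rfl)

/-- The multiplicity of `y` in `x` (at most `1` for the absorptive theories). -/
noncomputable def Model.cnt (y x : Model T F) : ℕ := (Model.exists_cnt y).choose x

theorem Model.cnt_app {n : ℕ} {f : Fun F n} {xs : Fin n → Model T F} (hf : ¬ f.IsCons)
    (y : Model T F) : Model.cnt y (Model.app f xs) = 0 :=
  (Model.exists_cnt y).choose_spec.1 n f xs hf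

open Classical in
theorem Model.cnt_cons (y a b : Model T F) :
    Model.cnt y (Model.cons a b) =
      if y = a then (if T.Absorptive then 1 else Model.cnt y b + 1) else Model.cnt y b :=
  (Model.exists_cnt y).choose_spec.2 a b

theorem Model.cnt_pos {y x : Model T F} :
    0 < Model.cnt y x ↔ Model.Mem y x := by
  induction x using Model.ind with
  | happ n f xs hf _ => simp [Model.cnt_app hf, Model.not_mem_app hf]
  | hcons a b _ ihb =>
    rw [Model.cnt_cons, Model.mem_cons, ← ihb]
    split_ifs <;> simp_all

theorem Model.cnt_le_one (ha : T.Absorptive) (y x : Model T F) :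
    Model.cnt y x ≤ 1 := by
  induction x using Model.ind with
  | happ n f xs hf _ => simp [Model.cnt_app hf]
  | hcons a b _ ihb =>
    rw [Model.cnt_cons]
    split_ifs <;> simp_all

open Classical in
theorem Model.cnt_foldr_of_not_absorptive (ha : ¬ T.Absorptive)
    (y k : Model T F) (l : List (Model T F)) :
    Model.cnt y (l.foldr Model.cons k) = l.count y + Model.cnt y k := by
  induction l with
  | nil => simp
  | cons a l ih =>
    rw [List.foldr_cons, Model.cnt_cons, ih, List.count_cons]
    simp only [beq_iff_eq, ha, if_false, eq_comm (a := a)]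
    split_ifs <;> omega

theorem Model.exists_foldr (x : Model T F) :
    ∃ l : List (Model T F), x = l.foldr Model.cons x.ker := by
  induction x using Model.ind with
  | happ n f xs hf _ => exact ⟨[], (Model.ker_app hf).symm⟩
  | hcons a b _ ihb =>
    obtain ⟨l, hl⟩ := ihb
    refine ⟨a :: l, ?_⟩
    rw [Model.ker_cons, List.foldr_cons, ← hl]

theorem Model.cons_eq_of_mem (hT : T.Permutative) (ha : T.Absorptive) {a x : Model T F}
    (h : Model.Mem a x) : Model.cons a x = x := by
  induction x using Model.ind with
  | happ n f xs hf _ => exact (Model.not_mem_app hf a h).elim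
  | hcons b c _ ihc =>
    rcases Model.mem_cons.1 h with rfl | h
    · exact Model.cons_absorb ha _ _
    · rw [Model.cons_comm hT, ihc h]

theorem Model.cnt_ker (x y : Model T F) : Model.cnt y x.ker = 0 := by
  induction x using Model.ind with
  | happ n f xs hf _ => rw [Model.ker_app hf, Model.cnt_app hf]
  | hcons b c _ ihc => rwa [Model.ker_cons]

/-- Without absorption, the lists of elements have equal counts and are permutations of each other.
With absorption, prepending members changes nothing: prepending to each aggregate the elements of
the other turns both into the same elements over the same kernel, up to order. -/
theorem Model.ext_cnt (hT : T.Permutative) {x y : Model T F}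
    (h₁ : ∀ z, Model.cnt z x = Model.cnt z y) (h₂ : x.ker = y.ker) : x = y := by
  classical
  obtain ⟨l, hl⟩ := x.exists_foldr
  obtain ⟨l', hl'⟩ := y.exists_foldr
  have lc : LeftCommutative (Model.cons (T := T) (F := F)) := ⟨Model.cons_comm hT⟩
  by_cases ha : T.Absorptive
  · have absorb : ∀ (l : List (Model T F)) (z : Model T F), (∀ a ∈ l, Model.Mem a z) →
        l.foldr Model.cons z = z := by
      intro l z h
      induction l with
      | nil => rfl
      | cons a l ih =>
        rw [List.foldr_cons, ih fun b hb => h b (by simp [hb])]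
        exact Model.cons_eq_of_mem hT ha (h a (by simp))
    have e₁ : l.foldr Model.cons y = y := absorb l y fun a h => by
      rw [← Model.cnt_pos, ← h₁, Model.cnt_pos, hl]
      exact Model.mem_foldr.2 (Or.inl h)
    have e₂ : l'.foldr Model.cons x = x := absorb l' x fun a h => by
      rw [← Model.cnt_pos, h₁, Model.cnt_pos, hl']
      exact Model.mem_foldr.2 (Or.inl h)
    rw [← e₁, ← e₂]
    conv_rhs => rw [hl']
    conv_lhs => rw [hl]
    rw [← List.foldr_append, ← List.foldr_append, h₂]
    exact List.Perm.foldr_eq List.perm_append_comm _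
  · rw [hl, hl', h₂]
    refine List.Perm.foldr_eq (List.perm_iff_count.2 fun a => ?_) _
    have := h₁ a
    rw [hl, hl', Model.cnt_foldr_of_not_absorptive ha,
      Model.cnt_foldr_of_not_absorptive ha, Model.cnt_ker, Model.cnt_ker] at this
    omega

end ModelAPI

/-! The shape of a term, read off from its number. -/

/-- The code of the head symbol of a compound term. -/
def headCode (i : ℕ) : ℕ := i.unpair.2.unpair.1

/-- The codes of the arguments of a compound term. -/
def argCodes (i : ℕ) : List ℕ := Denumerable.ofNat (List ℕ) i.unpair.2.unpair.2

/-- The number of a compound term that is not an aggregate `[s | t]`. -/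
def IsAppCode (i : ℕ) : Prop := i.unpair.1 = 1 ∧ headCode i ≠ Nat.pair 1 0

/-- The number of an aggregate `[s | t]`. -/
def IsConsCode (i : ℕ) : Prop := i.unpair.1 = 1 ∧ headCode i = Nat.pair 1 0

def fstCode (i : ℕ) : ℕ := (argCodes i).getD 0 0

def sndCode (i : ℕ) : ℕ := (argCodes i).getD 1 0

/-- A finite set `D` of codes closed under subterms, with an interpretation of the head symbols of
the terms other than `[s | t]` by function symbols. -/
structure Interp {T : Kind} {F : ℕ → Type u} (B : ℕ) (D : ℕ → Prop)
    (app : ℕ → (ℕ → Model T F) → Model T F) : Prop where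
  lt : ∀ {i}, D i → i < B
  fst_mem : ∀ {i}, D i → IsConsCode i → D (fstCode i)
  snd_mem : ∀ {i}, D i → IsConsCode i → D (sndCode i)
  arg_mem : ∀ {i}, D i → IsAppCode i → ∀ {a}, a ∈ argCodes i → D a
  app_eq_iff : ∀ {i j}, D i → IsAppCode i → D j → IsAppCode j → ∀ x y,
    app i x = app j y ↔ headCode i = headCode j ∧ (argCodes i).map x = (argCodes j).map y
  exists_app : ∀ {i}, D i → IsAppCode i → ∀ x,
    ∃ (n : ℕ) (f : Fun F n) (xs : Fin n → Model T F), ¬ f.IsCons ∧ app i x = Model.app f xs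
  dep_lt : ∀ {i}, D i → IsAppCode i → ∀ x {a}, a ∈ argCodes i → (x a).dep < (app i x).dep
  dep_le : ∀ {i}, D i → IsAppCode i → ∀ x m, (∀ a ∈ argCodes i, (x a).dep ≤ m) →
    (app i x).dep ≤ m + 1

namespace Interp

variable {T : Kind} {F : ℕ → Type u} {B : ℕ} {D : ℕ → Prop}
  {app : ℕ → (ℕ → Model T F) → Model T F}

theorem ker_app (h : Interp B D app) {i : ℕ} (hi : D i) (hi' : IsAppCode i)
    (x : ℕ → Model T F) : (app i x).ker = app i x := by
  obtain ⟨n, f, xs, hf, e⟩ := h.exists_app hi hi' x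
  rw [e, Model.ker_app hf]

theorem not_mem_app (h : Interp B D app) {i : ℕ} (hi : D i) (hi' : IsAppCode i)
    (x : ℕ → Model T F) (y : Model T F) : ¬ Model.Mem y (app i x) := by
  obtain ⟨n, f, xs, hf, e⟩ := h.exists_app hi hi' x
  rw [e]
  exact Model.not_mem_app hf y

theorem cnt_app (h : Interp B D app) {i : ℕ} (hi : D i) (hi' : IsAppCode i)
    (x : ℕ → Model T F) (y : Model T F) : Model.cnt y (app i x) = 0 := by
  obtain ⟨n, f, xs, hf, e⟩ := h.exists_app hi hi' x
  rw [e, Model.cnt_app hf]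

theorem elts_app (h : Interp B D app) {i : ℕ} (hi : D i) (hi' : IsAppCode i)
    (x : ℕ → Model T F) : (app i x).elts = [] := by
  obtain ⟨n, f, xs, hf, e⟩ := h.exists_app hi hi' x
  rw [e, Model.elts_app hf]

theorem app_ne_cons (h : Interp B D app) {i : ℕ} (hi : D i) (hi' : IsAppCode i)
    (x : ℕ → Model T F) (a b : Model T F) : app i x ≠ Model.cons a b := by
  obtain ⟨n, f, xs, hf, e⟩ := h.exists_app hi hi' x
  rw [e]
  exact Model.app_ne_cons hf a b

theorem app_congr (h : Interp B D app) {i : ℕ} (hi : D i) (hi' : IsAppCode i)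
    {x y : ℕ → Model T F} (e : ∀ a ∈ argCodes i, x a = y a) : app i x = app i y :=
  (h.app_eq_iff hi hi' hi hi' x y).2 ⟨rfl, List.map_congr_left e⟩

end Interp

/-- `v` gives the terms in `D` values that are compatible with the term structure. -/
structure IsValuation {T : Kind} {F : ℕ → Type u} (D : ℕ → Prop)
    (app : ℕ → (ℕ → Model T F) → Model T F) (v : ℕ → Model T F) : Prop where
  app_eq : ∀ {i}, D i → IsAppCode i → v i = app i v
  cons_eq : ∀ {i}, D i → IsConsCode i → v i = Model.cons (v (fstCode i)) (v (sndCode i))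

theorem eq_of_map_eq_map {α β : Type*} {f : α → β} {l l' : List α}
    (h : ∀ a ∈ l, ∀ b ∈ l', f a = f b → a = b) (e : l.map f = l'.map f) : l = l' := by
  induction l generalizing l' with
  | nil => simpa [eq_comm] using e
  | cons a l ih =>
    cases l' with
    | nil => simp at e
    | cons b l' =>
      simp only [List.map_cons, List.cons.injEq] at e
      rw [h a (by simp) b (by simp) e.1, ih (fun x hx y hy => h x (by simp [hx]) y (by simp [hy])) e.2]

/-- Recursion along a rank function. -/
theorem exists_rank_rec {α : Type*} (rk : ℕ → ℕ) (d : α) (body : (ℕ → α) → ℕ → α) :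
    ∃ h : ℕ → α, ∀ q, h q = body (fun p => if rk p < rk q then h p else d) q := by
  -- At arguments of rank not below that of `q`, `body` sees the default `d`. It can thus be an
  -- arbitrary functional, and each use has to check that the default is never consulted.
  refine ⟨WellFounded.fix (InvImage.wf rk Nat.lt_wfRel.wf)
    fun q rec => body (fun p => if hp : rk p < rk q then rec p hp else d) q, fun q => ?_⟩
  rw [WellFounded.fix_eq]
  simp only [dite_eq_ite]

/-- A finite description of a valuation up to the equalities and memberships between its values,
for the theories with permutativity: `cl` gives the classes of equal terms, `rk` orders them, `K`
gives the components of classes linked by `[s | t]` and `t`, and `cnt` the multiplicities. -/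
structure CommPattern (abs : Prop) (D : ℕ → Prop) (cl rk K : ℕ → ℕ) (cnt : ℕ → ℕ → ℕ) : Prop where
  cl_mem : ∀ i, D i → D (cl i) ∧ cl (cl i) = cl i
  app_eq : ∀ i, D i → IsAppCode i → ∀ j, D j → IsAppCode j →
    (cl i = cl j ↔ headCode i = headCode j ∧ (argCodes i).map cl = (argCodes j).map cl)
  -- The bound is imposed for every class of the component, because each of their values is built on
  -- the common kernel `f(…)`.
  app_rk : ∀ i, D i → IsAppCode i → ∀ a ∈ argCodes i, ∀ j, D j → K (cl j) = K (cl i) →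
    rk (cl a) < rk (cl j)
  app_K : ∀ i, D i → IsAppCode i → ∀ j, D j → IsAppCode j → K (cl i) = K (cl j) → cl i = cl j
  app_cnt : ∀ i, D i → IsAppCode i → ∀ c, D c → cnt (cl c) (cl i) = 0
  cons_K : ∀ i, D i → IsConsCode i → K (cl i) = K (cl (sndCode i))
  cons_cnt_ne : ∀ i, D i → IsConsCode i → ∀ c, D c → cl c ≠ cl (fstCode i) →
    cnt (cl c) (cl i) = cnt (cl c) (cl (sndCode i))
  cons_cnt_eq : ¬ abs → ∀ i, D i → IsConsCode i → ∀ c, D c → cl c = cl (fstCode i) →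
    cnt (cl c) (cl i) = cnt (cl c) (cl (sndCode i)) + 1
  cons_cnt_eq_one : abs → ∀ i, D i → IsConsCode i → ∀ c, D c → cl c = cl (fstCode i) →
    cnt (cl c) (cl i) = 1
  cnt_le_one : abs → ∀ c, D c → ∀ i, D i → cnt (cl c) (cl i) ≤ 1
  rk_lt : ∀ c, D c → ∀ i, D i → cnt (cl c) (cl i) ≠ 0 → rk (cl c) < rk (cl i)
  -- Linked values agree on all elements that are not values of subterms, so the recorded
  -- multiplicities decide equality inside a component.
  ext : ∀ i, D i → ∀ j, D j → K (cl i) = K (cl j) →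
    (∀ c, D c → cnt (cl c) (cl i) = cnt (cl c) (cl j)) → cl i = cl j

/-! ### Realisation of patterns for multisets and sets. -/

section CommSound

variable {T : Kind} {F : ℕ → Type u}

theorem Model.cnt_foldr_of_notMem {z k : Model T F} {l : List (Model T F)} (h : z ∉ l) :
    Model.cnt z (l.foldr Model.cons k) = Model.cnt z k := by
  induction l with
  | nil => rfl
  | cons a l ih =>
    rw [List.mem_cons, not_or] at h
    rw [List.foldr_cons, Model.cnt_cons, if_neg h.1, ih h.2]

/-- A function on classes that builds each value from its elements and the kernel of its
component. -/
theorem CommPattern.exists_build {B : ℕ} {D : ℕ → Prop} {app : ℕ → (ℕ → Model T F) → Model T F}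
    (hI : Interp B D app) {abs : Prop} {cl rk K : ℕ → ℕ} {cnt : ℕ → ℕ → ℕ}
    (P : CommPattern abs D cl rk K cnt) (M : ℕ) (reps : List ℕ)
    (hreps : ∀ q, q ∈ reps ↔ D q ∧ cl q = q) :
    ∃ (h base : ℕ → Model T F),
      (∀ q ∈ reps, h q =
        (reps.flatMap fun p => List.replicate (cnt p q) (h p)).foldr Model.cons (base (K q))) ∧
      (∀ i, D i → IsAppCode i → base (K (cl i)) = app i fun a => h (cl a)) ∧
      ∀ q, (¬ ∃ i, D i ∧ IsAppCode i ∧ K (cl i) = K q) →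
        base (K q) = Model.cons (Model.fresh M (K q)) Model.nil := by
  classical
  -- A component containing a term `f(…)` has it as kernel; by `app_K` and `app_eq` the choice of
  -- that term is immaterial. Any other component receives a marker of its own over `nil`.
  let base : (ℕ → Model T F) → ℕ → Model T F := fun h κ =>
    if hx : ∃ i, D i ∧ IsAppCode i ∧ K (cl i) = κ then app hx.choose fun a => h (cl a)
    else Model.cons (Model.fresh M κ) Model.nil
  obtain ⟨h, hh⟩ := exists_rank_rec rk (Model.nil : Model T F) fun h q =>
    (reps.flatMap fun p => List.replicate (cnt p q) (h p)).foldr Model.cons (base h (K q))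
  have hcl : ∀ {q}, q ∈ reps → cl q = q := fun hq => ((hreps _).1 hq).2
  have hD : ∀ {q}, q ∈ reps → D q := fun hq => ((hreps _).1 hq).1
  refine ⟨h, base h, fun q hq => ?_, fun i hi hi' => ?_, fun q hq => dif_neg hq⟩
  -- Only smaller ranks are consulted: for the arguments of the kernel by `app_rk`, for the elements
  -- by `rk_lt`.
  · rw [hh q]
    congr 1
    · simp only [base]
      split_ifs with hx
      · obtain ⟨h₁, h₂, h₃⟩ := hx.choose_spec
        refine hI.app_congr h₁ h₂ fun a ha => if_pos ?_
        have := P.app_rk _ h₁ h₂ a ha q (hD hq) (by rw [hcl hq, h₃])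
        rwa [hcl hq] at this
      · rfl
    · refine List.flatMap_congr fun p hp => ?_
      by_cases h0 : cnt p q = 0
      · simp [h0]
      · beta_reduce
        rw [if_pos]
        have := P.rk_lt p (hD hp) q (hD hq) (by rwa [hcl hp, hcl hq])
        rwa [hcl hp, hcl hq] at this
  · have hx : ∃ j, D j ∧ IsAppCode j ∧ K (cl j) = K (cl i) := ⟨i, hi, hi', rfl⟩
    refine (dif_pos hx).trans ?_
    obtain ⟨h₁, h₂, h₃⟩ := hx.choose_spec
    obtain ⟨e₁, e₂⟩ := (P.app_eq _ h₁ h₂ i hi hi').1 (P.app_K _ h₁ h₂ i hi hi' h₃)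
    refine (hI.app_eq_iff h₁ h₂ hi hi' _ _).2 ⟨e₁, ?_⟩
    simpa [List.map_map, Function.comp_def] using congrArg (List.map h) e₂

/-- Each class gets the prescribed multiplicities of earlier values over the base of its component.
Since no value is a marker, components can be recognised from the values; by induction on the rank,
different classes then get different values. After that, the true multiplicities are the prescribed
ones. -/
theorem CommPattern.sound (hT : T.Permutative) {B : ℕ} {D : ℕ → Prop}
    {app : ℕ → (ℕ → Model T F) → Model T F} (hI : Interp B D app) {cl rk K : ℕ → ℕ}
    {cnt : ℕ → ℕ → ℕ} (P : CommPattern T.Absorptive D cl rk K cnt) :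
    ∃ v : ℕ → Model T F, IsValuation D app v ∧
      (∀ i j, D i → D j → (v i = v j ↔ cl i = cl j)) ∧
      ∀ i j, D i → D j → (Model.Mem (v i) (v j) ↔ cnt (cl i) (cl j) ≠ 0) := by
  classical
  -- `M` exceeds all ranks, which places the markers above the values of small depth, and all names
  -- of components, so that each has its own marker.
  obtain ⟨M, hM⟩ : ∃ M, ∀ i, i < B → rk i < M ∧ K i < M := by
    refine ⟨(Finset.range B).sup (fun i => max (rk i) (K i)) + 1, fun i hi => ?_⟩
    have := Finset.le_sup (f := fun i => max (rk i) (K i)) (Finset.mem_range.2 hi)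
    omega
  let reps := (List.range B).filter fun q => D q ∧ cl q = q
  have hreps : ∀ q, q ∈ reps ↔ D q ∧ cl q = q := fun q => by
    simp only [reps, List.mem_filter, List.mem_range, decide_eq_true_eq]
    exact ⟨fun h => h.2, fun h => ⟨hI.lt h.1, h⟩⟩
  have hnd : reps.Nodup := List.nodup_range.filter _
  obtain ⟨h, base, hh, hb₁, hb₂⟩ := P.exists_build hI M reps hreps
  have hcl : ∀ {q}, q ∈ reps → cl q = q := fun hq => ((hreps _).1 hq).2
  have hD : ∀ {q}, q ∈ reps → D q := fun hq => ((hreps _).1 hq).1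
  have hrep : ∀ {i}, D i → cl i ∈ reps := fun hi => (hreps _).2 (P.cl_mem _ hi)
  have hrk : ∀ {q}, q ∈ reps → rk q < M := fun hq => (hM _ (hI.lt (hD hq))).1
  have hK : ∀ {q}, q ∈ reps → K q < M := fun hq => (hM _ (hI.lt (hD hq))).2
  have hlt : ∀ {p q}, p ∈ reps → q ∈ reps → cnt p q ≠ 0 → rk p < rk q := fun hp hq h0 => by
    have := P.rk_lt _ (hD hp) _ (hD hq) (by rwa [hcl hp, hcl hq])
    rwa [hcl hp, hcl hq] at this
  have hmemlist : ∀ {y q}, y ∈ (reps.flatMap fun p => List.replicate (cnt p q) (h p)) ↔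
      ∃ p ∈ reps, cnt p q ≠ 0 ∧ y = h p := fun {y q} => by
    simp only [List.mem_flatMap, List.mem_replicate]
  -- The depth of a value is at most its rank, unless a fresh element was used.
  have hdep : ∀ n, ∀ q ∈ reps, rk q < n → (h q).dep ≤ rk q + 1 ∨ M + 3 ≤ (h q).dep := by
    intro n
    induction n with
    | zero => intro q _ hn; omega
    | succ n ih =>
      intro q hq hn
      have ihr : ∀ p ∈ reps, rk p < rk q → (h p).dep ≤ rk q ∨ M + 3 ≤ (h p).dep := fun p hp hpq => by
        have := ih p hp (by omega)
        omega
      rw [or_iff_not_imp_right, not_le]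
      intro hbig
      rw [hh q hq]
      rw [hh q hq] at hbig
      refine Model.dep_foldr_le ?_ fun a ha => ?_
      · have hbig' := (Model.dep_le_foldr _ _).trans_lt hbig
        by_cases hx : ∃ i, D i ∧ IsAppCode i ∧ K (cl i) = K q
        · obtain ⟨i, hi, hi', hiK⟩ := hx
          rw [← hiK, hb₁ i hi hi'] at hbig' ⊢
          refine hI.dep_le hi hi' _ _ fun a ha => ?_
          have h₁ := hI.dep_lt hi hi' (fun a => h (cl a)) ha
          have h₂ := P.app_rk i hi hi' a ha q (hD hq) (by rw [hcl hq, hiK])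
          rw [hcl hq] at h₂
          have := ihr _ (hrep (hI.arg_mem hi hi' ha)) h₂
          omega
        · rw [hb₂ q hx, Model.dep_cons, Model.dep_fresh (hK hq)] at hbig'
          omega
      · have hlt' : a.dep < M + 3 :=
          (Model.dep_lt_of_mem (Model.mem_foldr.2 (Or.inl ha))).trans hbig
        obtain ⟨p, hp, h0, rfl⟩ := hmemlist.1 ha
        have := ihr p hp (hlt hp hq h0)
        omega
  -- A marker has depth exactly `M + 2`, strictly between `rk q + 1 ≤ M` and `M + 3`.
  have hfresh : ∀ q ∈ reps, ∀ κ < M, h q ≠ Model.fresh M κ := by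
    intro q hq κ hκ e
    have h₁ := hdep _ q hq (Nat.lt_succ_self _)
    rw [e, Model.dep_fresh hκ] at h₁
    have := hrk hq
    omega
  have hcnt_base : ∀ c ∈ reps, ∀ q ∈ reps, Model.cnt (h c) (base (K q)) = 0 := by
    intro c hc q hq
    by_cases hx : ∃ i, D i ∧ IsAppCode i ∧ K (cl i) = K q
    · obtain ⟨i, hi, hi', hiK⟩ := hx
      rw [← hiK, hb₁ i hi hi', hI.cnt_app hi hi']
    · rw [hb₂ q hx, Model.cnt_cons, if_neg (hfresh c hc _ (hK hq)), Model.nil,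
        Model.cnt_app Fun.not_isCons_nil]
  -- Only classes of rank below that of `q` need to be distinguished from `c`. In this form the
  -- count can be used inside the induction that proves injectivity of `h`.
  have hcnt : ∀ c ∈ reps, ∀ q ∈ reps, (∀ p ∈ reps, rk p < rk q → h p = h c → p = c) →
      Model.cnt (h c) (h q) = cnt c q := by
    intro c hc q hq hinj
    have hsupp : ∀ p ∈ reps, cnt p q ≠ 0 → h p = h c → p = c := fun p hp h0 =>
      hinj p hp (hlt hp hq h0)
    by_cases ha : T.Absorptive
    · have h₁ := Model.cnt_le_one ha (h c) (h q)
      have h₂ := P.cnt_le_one ha c (hD hc) q (hD hq)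
      rw [hcl hc, hcl hq] at h₂
      have h₃ : 0 < Model.cnt (h c) (h q) ↔ cnt c q ≠ 0 := by
        have h₀ : ¬ Model.Mem (h c) (base (K q)) := by
          rw [← Model.cnt_pos, hcnt_base c hc q hq]
          exact lt_irrefl 0
        rw [Model.cnt_pos, hh q hq, Model.mem_foldr, or_iff_left h₀, hmemlist]
        constructor
        · rintro ⟨p, hp, h0, e⟩
          rwa [← hsupp p hp h0 e.symm]
        · exact fun h0 => ⟨c, hc, h0, rfl⟩
      omega
    · rw [hh q hq, Model.cnt_foldr_of_not_absorptive ha, hcnt_base c hc q hq, List.count_flatMap,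
        List.sum_map_eq_nsmul_single c, List.count_eq_one_of_mem hnd hc]
      · simp
      · intro p hpc hp
        simp only [Function.comp_apply, List.count_replicate]
        split_ifs with e
        · by_contra h0
          exact hpc (hsupp p hp h0 (by simpa using e))
        · rfl
  have hbase_mem : ∀ q ∈ reps, ∀ κ < M, Model.Mem (Model.fresh M κ) (h q) ↔
      (¬ ∃ i, D i ∧ IsAppCode i ∧ K (cl i) = K q) ∧ κ = K q := by
    intro q hq κ hκ
    have h₁ : ¬ Model.fresh M κ ∈ (reps.flatMap fun p => List.replicate (cnt p q) (h p)) := by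
      rw [hmemlist]
      rintro ⟨p, hp, -, e⟩
      exact hfresh p hp κ hκ e.symm
    rw [hh q hq, Model.mem_foldr, or_iff_right h₁]
    by_cases hx : ∃ i, D i ∧ IsAppCode i ∧ K (cl i) = K q
    · simp only [hx, not_true, false_and, iff_false]
      obtain ⟨i, hi, hi', hiK⟩ := hx
      rw [← hiK, hb₁ i hi hi']
      exact hI.not_mem_app hi hi' _ _
    · rw [hb₂ q hx]
      simp only [hx, not_false_eq_true, true_and, Model.mem_cons, Model.not_mem_nil, or_false]
      exact ⟨fun e => Model.fresh_inj hκ e, fun e => by rw [e]⟩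
  have hinj : ∀ n, ∀ q ∈ reps, rk q < n → ∀ p ∈ reps, rk p < n → h p = h q → p = q := by
    intro n
    induction n with
    | zero => intro q _ hn; omega
    | succ n ih =>
      intro q hq hqn p hp hpn e
      -- Equal values lie in one component. Two kernels `f(…)` are compared through their arguments,
      -- which have smaller rank; a component without such a kernel is recognised by its marker.
      have hKeq : K p = K q := by
        by_cases hxp : ∃ i, D i ∧ IsAppCode i ∧ K (cl i) = K p
        · by_cases hxq : ∃ i, D i ∧ IsAppCode i ∧ K (cl i) = K q
          · obtain ⟨i, hi, hi', hiK⟩ := hxp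
            obtain ⟨j, hj, hj', hjK⟩ := hxq
            have hk := congrArg Model.ker e
            rw [hh p hp, hh q hq, Model.ker_foldr, Model.ker_foldr, ← hiK, ← hjK, hb₁ i hi hi',
              hb₁ j hj hj', hI.ker_app hi hi', hI.ker_app hj hj',
              hI.app_eq_iff hi hi' hj hj'] at hk
            obtain ⟨e₁, e₂⟩ := hk
            rw [← hiK, ← hjK, (P.app_eq i hi hi' j hj hj').2 ⟨e₁, ?_⟩]
            have e₂' : ((argCodes i).map cl).map h = ((argCodes j).map cl).map h := by
              simpa [List.map_map, Function.comp_def] using e₂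
            refine eq_of_map_eq_map ?_ e₂'
            rintro x hx y hy hxy
            obtain ⟨a, ha, rfl⟩ := List.mem_map.1 hx
            obtain ⟨b, hb, rfl⟩ := List.mem_map.1 hy
            have h₁ := P.app_rk i hi hi' a ha p (hD hp) (by rw [hcl hp, hiK])
            have h₂ := P.app_rk j hj hj' b hb q (hD hq) (by rw [hcl hq, hjK])
            rw [hcl hp] at h₁
            rw [hcl hq] at h₂
            exact ih _ (hrep (hI.arg_mem hj hj' hb)) (by omega) _ (hrep (hI.arg_mem hi hi' ha))
              (by omega) hxy
          · have := (hbase_mem q hq _ (hK hq)).2 ⟨hxq, rfl⟩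
            rw [← e] at this
            exact (((hbase_mem p hp _ (hK hq)).1 this).1 hxp).elim
        · have := (hbase_mem p hp _ (hK hp)).2 ⟨hxp, rfl⟩
          rw [e] at this
          exact ((hbase_mem q hq _ (hK hp)).1 this).2
      have := P.ext p (hD hp) q (hD hq) (by rwa [hcl hp, hcl hq]) fun c hc => by
        rw [hcl hp, hcl hq]
        -- The ranks of `p` and `q` are at most `n`, so a class of rank at least `n` is an element
        -- of neither.
        by_cases hcn : rk (cl c) < n
        · rw [← hcnt (cl c) (hrep hc) p hp fun p' hp' hr hpc =>
              ih _ (hrep hc) hcn p' hp' (by omega) hpc, e,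
            hcnt (cl c) (hrep hc) q hq fun p' hp' hr hpc =>
              ih _ (hrep hc) hcn p' hp' (by omega) hpc]
        · have h₁ : cnt (cl c) p = 0 := by
            by_contra h0
            have := hlt (hrep hc) hp h0
            omega
          have h₂ : cnt (cl c) q = 0 := by
            by_contra h0
            have := hlt (hrep hc) hq h0
            omega
          rw [h₁, h₂]
      rwa [hcl hp, hcl hq] at this
  have hinj' : ∀ q ∈ reps, ∀ p ∈ reps, h p = h q → p = q := fun q hq p hp =>
    hinj M q hq (hrk hq) p hp (hrk hp)
  have hcnt' : ∀ c ∈ reps, ∀ q ∈ reps, Model.cnt (h c) (h q) = cnt c q := fun c hc q hq =>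
    hcnt c hc q hq fun p hp _ e => hinj' c hc p hp e
  refine ⟨fun i => h (cl i), ⟨fun {i} hi hi' => ?_, fun {i} hi hi' => ?_⟩, fun i j hi hj => ?_,
    fun i j hi hj => ?_⟩
  · rw [hh _ (hrep hi), hb₁ i hi hi', List.flatMap_eq_nil_iff.2]
    · rfl
    · intro p hp
      have := P.app_cnt i hi hi' p (hD hp)
      rw [hcl hp] at this
      rw [this, List.replicate_zero]
  · have ha := hI.fst_mem hi hi'
    have hb := hI.snd_mem hi hi'
    refine Model.ext_cnt hT (fun z => ?_) ?_
    -- Values of classes are counted by `cnt`; any other element can only come from the base, which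
    -- both sides share by `cons_K`.
    · by_cases hz : ∃ c ∈ reps, z = h c
      · obtain ⟨c, hc, rfl⟩ := hz
        rw [Model.cnt_cons, hcnt' c hc _ (hrep hi), hcnt' c hc _ (hrep hb)]
        have hiff : h c = h (cl (fstCode i)) ↔ cl c = cl (fstCode i) :=
          ⟨fun e => by rw [hcl hc]; exact hinj' _ (hrep ha) c hc e, fun e => by rw [← e, hcl hc]⟩
        simp only [hiff]
        split_ifs with h₁ h₂
        · have := P.cons_cnt_eq_one h₂ i hi hi' c (hD hc) h₁
          rwa [hcl hc] at this
        · have := P.cons_cnt_eq h₂ i hi hi' c (hD hc) h₁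
          rwa [hcl hc] at this
        · have := P.cons_cnt_ne i hi hi' c (hD hc) h₁
          rwa [hcl hc] at this
      · have hz' : ∀ q, z ∉ (reps.flatMap fun p => List.replicate (cnt p q) (h p)) := by
          intro q hmem
          obtain ⟨p, hp, -, e⟩ := hmemlist.1 hmem
          exact hz ⟨p, hp, e⟩
        rw [Model.cnt_cons, if_neg fun e => hz ⟨_, hrep ha, e⟩, hh _ (hrep hi), hh _ (hrep hb),
          Model.cnt_foldr_of_notMem (hz' _), Model.cnt_foldr_of_notMem (hz' _),
          P.cons_K i hi hi']
    · rw [Model.ker_cons, hh _ (hrep hi), hh _ (hrep hb), Model.ker_foldr, Model.ker_foldr,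
        P.cons_K i hi hi']
  · exact ⟨hinj' _ (hrep hj) _ (hrep hi), fun e => by simp only [e]⟩
  · rw [← Model.cnt_pos, hcnt' _ (hrep hi) _ (hrep hj), Nat.pos_iff_ne_zero]

end CommSound

/-- A finite description of a valuation up to the equalities and memberships between its values,
for the theories without permutativity: `cl` gives the classes of equal terms, `rk` orders them,
`M` is membership, and `Col a b` says that `[a | b]` is equal to `b`. -/
structure ChainPattern (abs : Prop) (D : ℕ → Prop) (cl rk : ℕ → ℕ) (M Col : ℕ → ℕ → Prop) :
    Prop where
  cl_mem : ∀ i, D i → D (cl i) ∧ cl (cl i) = cl i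
  app_eq : ∀ i, D i → IsAppCode i → ∀ j, D j → IsAppCode j →
    (cl i = cl j ↔ headCode i = headCode j ∧ (argCodes i).map cl = (argCodes j).map cl)
  app_rk : ∀ i, D i → IsAppCode i → ∀ a ∈ argCodes i, rk (cl a) < rk (cl i)
  app_mem : ∀ i, D i → IsAppCode i → ∀ c, D c → ¬ M (cl c) (cl i)
  app_ne_cons : ∀ i, D i → IsAppCode i → ∀ j, D j → IsConsCode j → cl i ≠ cl j
  col_abs : ¬ abs → ∀ c, D c → ∀ i, D i → ¬ Col (cl c) (cl i)
  col_mem : ∀ c, D c → ∀ i, D i → Col (cl c) (cl i) → M (cl c) (cl i)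
  col_unique : ∀ c, D c → ∀ d, D d → ∀ i, D i → Col (cl c) (cl i) → Col (cl d) (cl i) →
    cl c = cl d
  cons_col : ∀ i, D i → IsConsCode i → Col (cl (fstCode i)) (cl (sndCode i)) →
    cl i = cl (sndCode i)
  -- A non-collapsing `[a | b]` is built from the values of both parts, so its rank must exceed that
  -- of `b` too, although its depth need not.
  cons_rk : ∀ i, D i → IsConsCode i → ¬ Col (cl (fstCode i)) (cl (sndCode i)) →
    rk (cl (fstCode i)) < rk (cl i) ∧ rk (cl (sndCode i)) < rk (cl i)
  cons_eq : ∀ i, D i → IsConsCode i → ¬ Col (cl (fstCode i)) (cl (sndCode i)) →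
    ∀ j, D j → IsConsCode j → ¬ Col (cl (fstCode j)) (cl (sndCode j)) →
      (cl i = cl j ↔ cl (fstCode i) = cl (fstCode j) ∧ cl (sndCode i) = cl (sndCode j))
  cons_mem : ∀ i, D i → IsConsCode i → ¬ Col (cl (fstCode i)) (cl (sndCode i)) → ∀ c, D c →
    (M (cl c) (cl i) ↔ cl c = cl (fstCode i) ∨ M (cl c) (cl (sndCode i)))
  cons_first : abs → ∀ i, D i → IsConsCode i → ¬ Col (cl (fstCode i)) (cl (sndCode i)) →
    ∀ c, D c → (Col (cl c) (cl i) ↔ cl c = cl (fstCode i))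
  rk_lt : ∀ c, D c → ∀ i, D i → M (cl c) (cl i) → rk (cl c) < rk (cl i)

/-! ### Realisation of patterns for lists and compact lists. -/

section ChainSound

variable {T : Kind} {F : ℕ → Type u}

theorem Model.head?_elts_cons (hT : ¬ T.Permutative) (a b : Model T F) :
    (Model.cons a b).elts.head? = some a := by
  rw [Model.elts_cons hT]
  split_ifs with h
  · exact h.2
  · rfl

theorem Model.elts_cons_of_head?_ne (hT : ¬ T.Permutative) {a b : Model T F}
    (h : T.Absorptive → b.elts.head? ≠ some a) : (Model.cons a b).elts = a :: b.elts := by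
  rw [Model.elts_cons hT, if_neg fun e => h e.1 e.2]

theorem Model.elts_cons_of_not_mem (hT : ¬ T.Permutative) {a b : Model T F}
    (h : ¬ Model.Mem a b) : (Model.cons a b).elts = a :: b.elts :=
  Model.elts_cons_of_head?_ne hT fun _ e => h ((Model.mem_elts hT).1 (List.mem_of_head? e))

theorem Model.cons_eq_of_head? (hT : ¬ T.Permutative) (ha : T.Absorptive) {a b : Model T F}
    (h : b.elts.head? = some a) : Model.cons a b = b := by
  refine Model.ext_elts hT ?_ (Model.ker_cons a b)
  rw [Model.elts_cons hT, if_pos ⟨ha, h⟩]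

/-- The class consists neither of terms `f(…)` nor of terms `[a | b]` different from `b`. -/
def IsRoot (D : ℕ → Prop) (cl : ℕ → ℕ) (Col : ℕ → ℕ → Prop) (q : ℕ) : Prop :=
  (¬ ∃ i, D i ∧ IsAppCode i ∧ cl i = q) ∧
    ¬ ∃ i, D i ∧ IsConsCode i ∧ ¬ Col (cl (fstCode i)) (cl (sndCode i)) ∧ cl i = q

/-- The value of a root class is not dictated by the term structure: it is a marker followed by all
prescribed members, in any order. If `[c | q] = q` is prescribed, `c` has to come first and the
marker moves to the second place. Even and odd indices separate the two kinds of markers. -/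
theorem ChainPattern.exists_build {B : ℕ} {D : ℕ → Prop} {app : ℕ → (ℕ → Model T F) → Model T F}
    (hI : Interp B D app) {abs : Prop} {cl rk : ℕ → ℕ} {M Col : ℕ → ℕ → Prop}
    (P : ChainPattern abs D cl rk M Col) (N : ℕ) (reps : List ℕ)
    (hreps : ∀ q, q ∈ reps ↔ D q ∧ cl q = q) :
    ∃ (h tail : ℕ → Model T F),
      (∀ i, D i → IsAppCode i → h (cl i) = app i fun a => h (cl a)) ∧
      (∀ i, D i → IsConsCode i → ¬ Col (cl (fstCode i)) (cl (sndCode i)) →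
        h (cl i) = Model.cons (h (cl (fstCode i))) (h (cl (sndCode i)))) ∧
      (∀ q ∈ reps, ∀ x, Model.Mem x (tail q) ↔ ∃ p ∈ reps, M p q ∧ x = h p) ∧
      (∀ q ∈ reps, IsRoot D cl Col q → (¬ ∃ c ∈ reps, Col c q) →
        h q = Model.cons (Model.fresh N (2 * q)) (tail q)) ∧
      ∀ q ∈ reps, IsRoot D cl Col q → ∀ c ∈ reps, Col c q →
        h q = Model.cons (h c) (Model.cons (Model.fresh N (2 * q + 1)) (tail q)) := by
  classical
  let tail : (ℕ → Model T F) → ℕ → Model T F := fun h q =>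
    ((reps.filter fun p => M p q).map h).foldr Model.cons Model.nil
  obtain ⟨h, hh⟩ := exists_rank_rec rk (Model.nil : Model T F) fun h q =>
    if hx : ∃ i, D i ∧ IsAppCode i ∧ cl i = q then app hx.choose fun a => h (cl a)
    else if hy : ∃ i, D i ∧ IsConsCode i ∧ ¬ Col (cl (fstCode i)) (cl (sndCode i)) ∧ cl i = q then
      Model.cons (h (cl (fstCode hy.choose))) (h (cl (sndCode hy.choose)))
    else if hz : ∃ c ∈ reps, Col c q then
      Model.cons (h hz.choose) (Model.cons (Model.fresh N (2 * q + 1)) (tail h q))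
    else Model.cons (Model.fresh N (2 * q)) (tail h q)
  have hcl : ∀ {q}, q ∈ reps → cl q = q := fun hq => ((hreps _).1 hq).2
  have hD : ∀ {q}, q ∈ reps → D q := fun hq => ((hreps _).1 hq).1
  have hlt : ∀ {p q}, p ∈ reps → q ∈ reps → M p q → rk p < rk q := fun hp hq h0 => by
    have := P.rk_lt _ (hD hp) _ (hD hq) (by rwa [hcl hp, hcl hq])
    rwa [hcl hp, hcl hq] at this
  have htail : ∀ q ∈ reps, tail (fun p => if rk p < rk q then h p else Model.nil) q = tail h q := by
    intro q hq
    simp only [tail]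
    congr 1
    refine List.map_congr_left fun p hp => if_pos ?_
    rw [List.mem_filter, decide_eq_true_eq] at hp
    exact hlt hp.1 hq hp.2
  refine ⟨h, tail h, fun i hi hi' => ?_, fun i hi hi' hc => ?_, fun q hq x => ?_,
    fun q hq hr hz => ?_, fun q hq hr c hc hcq => ?_⟩
  · have hx : ∃ j, D j ∧ IsAppCode j ∧ cl j = cl i := ⟨i, hi, hi', rfl⟩
    rw [hh, dif_pos hx]
    obtain ⟨h₁, h₂, h₃⟩ := hx.choose_spec
    obtain ⟨e₁, e₂⟩ := (P.app_eq _ h₁ h₂ i hi hi').1 h₃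
    refine (hI.app_eq_iff h₁ h₂ hi hi' _ _).2 ⟨e₁, ?_⟩
    have e₃ := congrArg (List.map h) e₂
    rw [List.map_map, List.map_map] at e₃
    refine Eq.trans (List.map_congr_left fun a ha => if_pos ?_) e₃
    rw [← h₃]
    exact P.app_rk _ h₁ h₂ a ha
  · have hx : ¬ ∃ j, D j ∧ IsAppCode j ∧ cl j = cl i := by
      rintro ⟨j, hj, hj', e⟩
      exact P.app_ne_cons j hj hj' i hi hi' e
    have hy : ∃ j, D j ∧ IsConsCode j ∧ ¬ Col (cl (fstCode j)) (cl (sndCode j)) ∧ cl j = cl i :=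
      ⟨i, hi, hi', hc, rfl⟩
    rw [hh, dif_neg hx, dif_pos hy]
    obtain ⟨h₁, h₂, h₃, h₄⟩ := hy.choose_spec
    obtain ⟨e₁, e₂⟩ := (P.cons_eq _ h₁ h₂ h₃ i hi hi' hc).1 h₄
    obtain ⟨r₁, r₂⟩ := P.cons_rk i hi hi' hc
    beta_reduce
    rw [e₁, e₂, if_pos r₁, if_pos r₂]
  · simp only [tail, Model.mem_foldr, Model.not_mem_nil, or_false, List.mem_map, List.mem_filter,
      decide_eq_true_eq, and_assoc, eq_comm (a := x)]
  · rw [hh, dif_neg hr.1, dif_neg hr.2, dif_neg hz, htail q hq]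
  · have hz : ∃ c ∈ reps, Col c q := ⟨c, hc, hcq⟩
    obtain ⟨h₁, h₂⟩ := hz.choose_spec
    have e : hz.choose = c := by
      have := P.col_unique _ (hD h₁) c (hD hc) q (hD hq) (by rwa [hcl h₁, hcl hq])
        (by rwa [hcl hc, hcl hq])
      rwa [hcl h₁, hcl hc] at this
    have hm : M c q := by
      have := P.col_mem c (hD hc) q (hD hq) (by rwa [hcl hc, hcl hq])
      rwa [hcl hc, hcl hq] at this
    rw [hh, dif_neg hr.1, dif_neg hr.2, dif_pos hz, htail q hq, e]
    beta_reduce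
    rw [if_pos (hlt hc hq hm)]

/-- Depth keeps markers and values apart. A root value is identified by its marker, in first or
second place. No value of a class starts with an odd marker, and no value is a marker, so a
non-collapsing `[a | b]` never equals a root value; two such aggregates are compared part by part.
-/
theorem ChainPattern.sound (hT : ¬ T.Permutative) {B : ℕ} {D : ℕ → Prop}
    {app : ℕ → (ℕ → Model T F) → Model T F} (hI : Interp B D app) {cl rk : ℕ → ℕ}
    {M Col : ℕ → ℕ → Prop} (P : ChainPattern T.Absorptive D cl rk M Col) :
    ∃ v : ℕ → Model T F, IsValuation D app v ∧
      (∀ i j, D i → D j → (v i = v j ↔ cl i = cl j)) ∧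
      ∀ i j, D i → D j → (Model.Mem (v i) (v j) ↔ M (cl i) (cl j)) := by
  classical
  -- Both `2 * q` and `2 * q + 1` have to be admissible marker indices for every class `q`.
  obtain ⟨N, hN⟩ : ∃ N, ∀ i, i < B → rk i < N ∧ 2 * i + 1 < N := by
    refine ⟨(Finset.range B).sup (fun i => max (rk i) (2 * i + 1)) + 1, fun i hi => ?_⟩
    have := Finset.le_sup (f := fun i => max (rk i) (2 * i + 1)) (Finset.mem_range.2 hi)
    omega
  let reps := (List.range B).filter fun q => D q ∧ cl q = q
  have hreps : ∀ q, q ∈ reps ↔ D q ∧ cl q = q := fun q => by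
    simp only [reps, List.mem_filter, List.mem_range, decide_eq_true_eq]
    exact ⟨fun h => h.2, fun h => ⟨hI.lt h.1, h⟩⟩
  obtain ⟨h, tail, happ, hcons, htail, hroot, hroot'⟩ := P.exists_build hI N reps hreps
  have hcl : ∀ {q}, q ∈ reps → cl q = q := fun hq => ((hreps _).1 hq).2
  have hD : ∀ {q}, q ∈ reps → D q := fun hq => ((hreps _).1 hq).1
  have hrep : ∀ {i}, D i → cl i ∈ reps := fun hi => (hreps _).2 (P.cl_mem _ hi)
  have hrk : ∀ {q}, q ∈ reps → rk q < N := fun hq => (hN _ (hI.lt (hD hq))).1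
  have hNq : ∀ {q}, q ∈ reps → 2 * q + 1 < N := fun hq => (hN _ (hI.lt (hD hq))).2
  have hlt : ∀ {p q}, p ∈ reps → q ∈ reps → M p q → rk p < rk q := fun hp hq h0 => by
    have := P.rk_lt _ (hD hp) _ (hD hq) (by rwa [hcl hp, hcl hq])
    rwa [hcl hp, hcl hq] at this
  have hcol : ∀ {p q}, p ∈ reps → q ∈ reps → Col p q → M p q := fun hp hq h0 => by
    have := P.col_mem _ (hD hp) _ (hD hq) (by rwa [hcl hp, hcl hq])
    rwa [hcl hp, hcl hq] at this
  -- The four kinds of classes.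
  have hcases : ∀ q ∈ reps, (∃ i, D i ∧ IsAppCode i ∧ cl i = q) ∨
      (∃ i, D i ∧ IsConsCode i ∧ ¬ Col (cl (fstCode i)) (cl (sndCode i)) ∧ cl i = q) ∨
      (IsRoot D cl Col q ∧ ¬ ∃ c ∈ reps, Col c q) ∨
      (IsRoot D cl Col q ∧ ∃ c ∈ reps, Col c q) := by
    intro q _
    unfold IsRoot
    tauto
  have hdep : ∀ n, ∀ q ∈ reps, rk q < n → (h q).dep ≤ rk q + 1 ∨ N + 3 ≤ (h q).dep := by
    intro n
    induction n with
    | zero => intro q _ hn; omega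
    | succ n ih =>
      intro q hq hn
      have ihr : ∀ p ∈ reps, rk p < rk q → (h p).dep ≤ rk q ∨ N + 3 ≤ (h p).dep := fun p hp hpq => by
        have := ih p hp (by omega)
        omega
      rcases hcases q hq with ⟨i, hi, hi', rfl⟩ | ⟨i, hi, hi', hc, rfl⟩ | ⟨hr, hz⟩ | ⟨hr, c, hc, hcq⟩
      · rw [or_iff_not_imp_right, not_le]
        intro hbig
        rw [happ i hi hi'] at hbig ⊢
        refine hI.dep_le hi hi' _ _ fun a ha => ?_
        have h₁ := hI.dep_lt hi hi' (fun a => h (cl a)) ha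
        have := ihr _ (hrep (hI.arg_mem hi hi' ha)) (P.app_rk i hi hi' a ha)
        omega
      · rw [hcons i hi hi' hc, Model.dep_cons]
        obtain ⟨r₁, r₂⟩ := P.cons_rk i hi hi' hc
        have h₁ := ihr _ (hrep (hI.fst_mem hi hi')) r₁
        have h₂ := ihr _ (hrep (hI.snd_mem hi hi')) r₂
        omega
      · right
        rw [hroot q hq hr hz, Model.dep_cons, Model.dep_fresh (by have := hNq hq; omega)]
        omega
      · right
        rw [hroot' q hq hr c hc hcq, Model.dep_cons, Model.dep_cons, Model.dep_fresh (hNq hq)]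
        omega
  have hfresh : ∀ q ∈ reps, ∀ κ < N, h q ≠ Model.fresh N κ := by
    intro q hq κ hκ e
    have h₁ := hdep _ q hq (Nat.lt_succ_self _)
    rw [e, Model.dep_fresh hκ] at h₁
    have := hrk hq
    omega
  have hroot_elts : ∀ q ∈ reps, IsRoot D cl Col q → (¬ ∃ c ∈ reps, Col c q) →
      (h q).elts = Model.fresh N (2 * q) :: (tail q).elts := by
    intro q hq hr hz
    rw [hroot q hq hr hz, Model.elts_cons_of_not_mem hT]
    rw [htail q hq]
    rintro ⟨p, hp, -, e⟩
    exact hfresh p hp _ (by have := hNq hq; omega) e.symm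
  have hroot_elts' : ∀ q ∈ reps, IsRoot D cl Col q → ∀ c ∈ reps, Col c q →
      (h q).elts = h c :: Model.fresh N (2 * q + 1) :: (tail q).elts := by
    intro q hq hr c hc hcq
    have e₁ : (Model.cons (Model.fresh N (2 * q + 1)) (tail q)).elts =
        Model.fresh N (2 * q + 1) :: (tail q).elts := by
      refine Model.elts_cons_of_not_mem hT ?_
      rw [htail q hq]
      rintro ⟨p, hp, -, e⟩
      exact hfresh p hp _ (hNq hq) e.symm
    rw [hroot' q hq hr c hc hcq, Model.elts_cons_of_head?_ne hT, e₁]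
    intro _
    rw [e₁, List.head?_cons, ne_eq, Option.some_inj]
    exact fun e => hfresh c hc _ (hNq hq) e.symm
  -- Hence what follows the first element of a root value of the second kind is not the value of any
  -- class.
  have hhead_odd : ∀ r ∈ reps, ∀ q ∈ reps,
      (h r).elts.head? ≠ some (Model.fresh N (2 * q + 1)) := by
    intro r hr q hq
    rcases hcases r hr with ⟨i, hi, hi', rfl⟩ | ⟨i, hi, hi', hc, rfl⟩ | ⟨hx, hz⟩ | ⟨hx, c, hc, hcr⟩
    · rw [happ i hi hi', hI.elts_app hi hi']
      simp
    · rw [hcons i hi hi' hc, Model.head?_elts_cons hT, ne_eq, Option.some_inj]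
      exact hfresh _ (hrep (hI.fst_mem hi hi')) _ (hNq hq)
    · rw [hroot_elts r hr hx hz, List.head?_cons, ne_eq, Option.some_inj]
      intro e
      have := Model.fresh_inj (by have := hNq hr; omega) e
      omega
    · rw [hroot_elts' r hr hx c hc hcr, List.head?_cons, ne_eq, Option.some_inj]
      exact hfresh c hc _ (hNq hq)
  have happ_ne : ∀ i, D i → IsAppCode i → ∀ q ∈ reps, (¬ ∃ i, D i ∧ IsAppCode i ∧ cl i = q) →
      h (cl i) ≠ h q := by
    intro i hi hi' q hq hx
    rw [happ i hi hi']
    rcases hcases q hq with hx' | ⟨j, hj, hj', hc, rfl⟩ | ⟨hr, hz⟩ | ⟨hr, c, hc, hcq⟩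
    · exact (hx hx').elim
    · rw [hcons j hj hj' hc]
      exact hI.app_ne_cons hi hi' _ _ _
    · rw [hroot q hq hr hz]
      exact hI.app_ne_cons hi hi' _ _ _
    · rw [hroot' q hq hr c hc hcq]
      exact hI.app_ne_cons hi hi' _ _ _
  have hcons_elts : ∀ i, D i → IsConsCode i → ¬ Col (cl (fstCode i)) (cl (sndCode i)) →
      (T.Absorptive → (h (cl (sndCode i))).elts.head? = some (h (cl (fstCode i))) →
        Col (cl (fstCode i)) (cl (sndCode i))) →
      (h (cl i)).elts = h (cl (fstCode i)) :: (h (cl (sndCode i))).elts := by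
    intro i hi hi' hc hhd
    rw [hcons i hi hi' hc, Model.elts_cons_of_head?_ne hT fun ha e => hc (hhd ha e)]
  have hcons_ne_root : ∀ i, D i → IsConsCode i → ¬ Col (cl (fstCode i)) (cl (sndCode i)) →
      (h (cl i)).elts = h (cl (fstCode i)) :: (h (cl (sndCode i))).elts →
      ∀ q ∈ reps, IsRoot D cl Col q → h (cl i) ≠ h q := by
    intro i hi hi' hc he q hq hr e
    have e' := congrArg Model.elts e
    rw [he] at e'
    by_cases hz : ∃ c ∈ reps, Col c q
    · obtain ⟨c, hc', hcq⟩ := hz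
      rw [hroot_elts' q hq hr c hc' hcq, List.cons.injEq] at e'
      refine hhead_odd _ (hrep (hI.snd_mem hi hi')) q hq ?_
      rw [e'.2, List.head?_cons]
    · rw [hroot_elts q hq hr hz, List.cons.injEq] at e'
      exact hfresh _ (hrep (hI.fst_mem hi hi')) _ (by have := hNq hq; omega) e'.1
  -- The two claims are proved together. Splitting `[a | b]` into its parts requires that `a` is not
  -- already the first element of `b`, and recognising first elements requires injectivity.
  have main : ∀ n, (∀ q ∈ reps, rk q < n → ∀ p ∈ reps, rk p < n → h p = h q → p = q) ∧
      (T.Absorptive → ∀ q ∈ reps, rk q < n → ∀ c ∈ reps, rk c < n →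
        (h q).elts.head? = some (h c) → Col c q) := by
    intro n
    induction n with
    | zero => exact ⟨fun q _ hn => by omega, fun _ q _ hn => by omega⟩
    | succ n ih =>
      obtain ⟨ih, ihd⟩ := ih
      have hce : ∀ i, D i → IsConsCode i → ¬ Col (cl (fstCode i)) (cl (sndCode i)) →
          rk (cl i) < n + 1 →
          (h (cl i)).elts = h (cl (fstCode i)) :: (h (cl (sndCode i))).elts := by
        intro i hi hi' hc hin
        obtain ⟨r₁, r₂⟩ := P.cons_rk i hi hi' hc
        exact hcons_elts i hi hi' hc fun ha => ihd ha _ (hrep (hI.snd_mem hi hi')) (by omega) _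
          (hrep (hI.fst_mem hi hi')) (by omega)
      have hinj : ∀ q ∈ reps, rk q < n + 1 → ∀ p ∈ reps, rk p < n + 1 → h p = h q → p = q := by
        intro q hq hqn p hp hpn e
        by_cases hxp : ∃ i, D i ∧ IsAppCode i ∧ cl i = p
        · obtain ⟨i, hi, hi', rfl⟩ := hxp
          by_cases hxq : ∃ i, D i ∧ IsAppCode i ∧ cl i = q
          · obtain ⟨j, hj, hj', rfl⟩ := hxq
            rw [happ i hi hi', happ j hj hj', hI.app_eq_iff hi hi' hj hj'] at e
            refine (P.app_eq i hi hi' j hj hj').2 ⟨e.1, ?_⟩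
            have e₂' : ((argCodes i).map cl).map h = ((argCodes j).map cl).map h := by
              simpa [List.map_map, Function.comp_def] using e.2
            refine eq_of_map_eq_map ?_ e₂'
            rintro x hx y hy hxy
            obtain ⟨a, ha, rfl⟩ := List.mem_map.1 hx
            obtain ⟨b, hb, rfl⟩ := List.mem_map.1 hy
            have h₁ := P.app_rk i hi hi' a ha
            have h₂ := P.app_rk j hj hj' b hb
            exact ih _ (hrep (hI.arg_mem hj hj' hb)) (by omega) _ (hrep (hI.arg_mem hi hi' ha))
              (by omega) hxy
          · exact (happ_ne i hi hi' q hq hxq e).elim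
        · by_cases hxq : ∃ i, D i ∧ IsAppCode i ∧ cl i = q
          · obtain ⟨j, hj, hj', rfl⟩ := hxq
            exact (happ_ne j hj hj' p hp hxp e.symm).elim
          · by_cases hyp : ∃ i, D i ∧ IsConsCode i ∧ ¬ Col (cl (fstCode i)) (cl (sndCode i)) ∧
                cl i = p
            · obtain ⟨i, hi, hi', hci, rfl⟩ := hyp
              by_cases hyq : ∃ i, D i ∧ IsConsCode i ∧
                  ¬ Col (cl (fstCode i)) (cl (sndCode i)) ∧ cl i = q
              · obtain ⟨j, hj, hj', hcj, rfl⟩ := hyq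
                have e' := congrArg Model.elts e
                rw [hce i hi hi' hci hpn, hce j hj hj' hcj hqn, List.cons.injEq] at e'
                have e'' := congrArg Model.ker e
                rw [hcons i hi hi' hci, hcons j hj hj' hcj, Model.ker_cons, Model.ker_cons] at e''
                obtain ⟨r₁, r₂⟩ := P.cons_rk i hi hi' hci
                obtain ⟨s₁, s₂⟩ := P.cons_rk j hj hj' hcj
                exact (P.cons_eq i hi hi' hci j hj hj' hcj).2
                  ⟨ih _ (hrep (hI.fst_mem hj hj')) (by omega) _ (hrep (hI.fst_mem hi hi'))
                    (by omega) e'.1,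
                  ih _ (hrep (hI.snd_mem hj hj')) (by omega) _ (hrep (hI.snd_mem hi hi'))
                    (by omega) (Model.ext_elts hT e'.2 e'')⟩
              · exact (hcons_ne_root i hi hi' hci (hce i hi hi' hci hpn) q hq ⟨hxq, hyq⟩ e).elim
            · by_cases hyq : ∃ i, D i ∧ IsConsCode i ∧
                  ¬ Col (cl (fstCode i)) (cl (sndCode i)) ∧ cl i = q
              · obtain ⟨j, hj, hj', hcj, rfl⟩ := hyq
                exact (hcons_ne_root j hj hj' hcj (hce j hj hj' hcj hqn) p hp ⟨hxp, hyp⟩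
                  e.symm).elim
              · have e' := congrArg Model.elts e
                have hNp := hNq hp
                have hNq' := hNq hq
                by_cases hzp : ∃ c ∈ reps, Col c p
                · obtain ⟨c, hc, hcp⟩ := hzp
                  rw [hroot_elts' p hp ⟨hxp, hyp⟩ c hc hcp] at e'
                  by_cases hzq : ∃ c ∈ reps, Col c q
                  · obtain ⟨d, hd, hdq⟩ := hzq
                    rw [hroot_elts' q hq ⟨hxq, hyq⟩ d hd hdq] at e'
                    simp only [List.cons.injEq] at e'
                    have := Model.fresh_inj hNp e'.2.1
                    omega
                  · rw [hroot_elts q hq ⟨hxq, hyq⟩ hzq, List.cons.injEq] at e'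
                    exact (hfresh c hc _ (by omega) e'.1).elim
                · rw [hroot_elts p hp ⟨hxp, hyp⟩ hzp] at e'
                  by_cases hzq : ∃ c ∈ reps, Col c q
                  · obtain ⟨d, hd, hdq⟩ := hzq
                    rw [hroot_elts' q hq ⟨hxq, hyq⟩ d hd hdq, List.cons.injEq] at e'
                    exact (hfresh d hd _ (by omega) e'.1.symm).elim
                  · rw [hroot_elts q hq ⟨hxq, hyq⟩ hzq, List.cons.injEq] at e'
                    have := Model.fresh_inj (by omega) e'.1
                    omega
      refine ⟨hinj, fun ha q hq hqn c hc hcn e => ?_⟩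
      rcases hcases q hq with ⟨i, hi, hi', rfl⟩ | ⟨i, hi, hi', hci, rfl⟩ | ⟨hr, hz⟩ |
        ⟨hr, d, hd, hdq⟩
      · rw [happ i hi hi', hI.elts_app hi hi'] at e
        simp at e
      · rw [hce i hi hi' hci hqn, List.head?_cons, Option.some_inj] at e
        obtain ⟨r₁, r₂⟩ := P.cons_rk i hi hi' hci
        have := hinj c hc hcn _ (hrep (hI.fst_mem hi hi')) (by omega) e
        have h₁ := (P.cons_first ha i hi hi' hci c (hD hc)).2 (by rw [hcl hc, this])
        rwa [hcl hc] at h₁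
      · rw [hroot_elts q hq hr hz, List.head?_cons, Option.some_inj] at e
        exact (hfresh c hc _ (by have := hNq hq; omega) e.symm).elim
      · rw [hroot_elts' q hq hr d hd hdq, List.head?_cons, Option.some_inj] at e
        have := hlt hd hq (hcol hd hq hdq)
        rwa [← hinj c hc hcn d hd (by omega) e]
  have hinj : ∀ q ∈ reps, ∀ p ∈ reps, h p = h q → p = q := fun q hq p hp =>
    (main N).1 q hq (hrk hq) p hp (hrk hp)
  have hiff : ∀ {p q}, p ∈ reps → q ∈ reps → (h p = h q ↔ p = q) := fun hp hq =>
    ⟨hinj _ hq _ hp, fun e => by rw [e]⟩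
  have hhead : T.Absorptive → ∀ q ∈ reps, ∀ c ∈ reps, Col c q →
      (h q).elts.head? = some (h c) := by
    intro ha q hq c hc hcq
    rcases hcases q hq with ⟨i, hi, hi', rfl⟩ | ⟨i, hi, hi', hci, rfl⟩ | ⟨hr, hz⟩ | ⟨hr, -⟩
    · have := P.app_mem i hi hi' c (hD hc)
      rw [hcl hc] at this
      exact (this (hcol hc hq hcq)).elim
    · have := (P.cons_first ha i hi hi' hci c (hD hc)).1 (by rwa [hcl hc])
      rw [hcons i hi hi' hci, Model.head?_elts_cons hT, ← this, hcl hc]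
    · exact (hz ⟨c, hc, hcq⟩).elim
    · rw [hroot_elts' q hq hr c hc hcq, List.head?_cons]
  have hmem : ∀ n, ∀ q ∈ reps, rk q < n → ∀ c ∈ reps, Model.Mem (h c) (h q) ↔ M c q := by
    intro n
    induction n with
    | zero => intro q _ hn; omega
    | succ n ih =>
      intro q hq hqn c hc
      have htl : Model.Mem (h c) (tail q) ↔ M c q := by
        rw [htail q hq]
        constructor
        · rintro ⟨p, hp, hm, e⟩
          rwa [hinj p hp c hc e]
        · exact fun hm => ⟨c, hc, hm, rfl⟩
      have hfr : ∀ κ < N, h c ≠ Model.fresh N κ := hfresh c hc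
      have hNq' := hNq hq
      rcases hcases q hq with ⟨i, hi, hi', rfl⟩ | ⟨i, hi, hi', hci, rfl⟩ | ⟨hr, hz⟩ |
        ⟨hr, d, hd, hdq⟩
      · have := P.app_mem i hi hi' c (hD hc)
        rw [hcl hc] at this
        rw [happ i hi hi']
        exact iff_of_false (hI.not_mem_app hi hi' _ _) this
      · obtain ⟨r₁, r₂⟩ := P.cons_rk i hi hi' hci
        have := P.cons_mem i hi hi' hci c (hD hc)
        rw [hcl hc] at this
        rw [this, hcons i hi hi' hci, Model.mem_cons, hiff hc (hrep (hI.fst_mem hi hi')),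
          ih _ (hrep (hI.snd_mem hi hi')) (by omega) c hc]
      · rw [hroot q hq hr hz, Model.mem_cons, htl, or_iff_right (hfr _ (by omega))]
      · rw [hroot' q hq hr d hd hdq, Model.mem_cons, Model.mem_cons, htl,
          or_iff_right (hfr _ hNq'), hiff hc hd]
        refine or_iff_right_of_imp ?_
        rintro rfl
        exact hcol hc hq hdq
  refine ⟨fun i => h (cl i), ⟨fun {i} hi hi' => happ i hi hi', fun {i} hi hi' => ?_⟩,
    fun i j hi hj => hiff (hrep hi) (hrep hj),
    fun i j hi hj => hmem N _ (hrep hj) (hrk (hrep hj)) _ (hrep hi)⟩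
  have hf := hI.fst_mem hi hi'
  have hs := hI.snd_mem hi hi'
  -- A prescribed collapse is possible only under absorption, and then it is genuine because the
  -- value of the rest begins with that of the first part.
  by_cases hc : Col (cl (fstCode i)) (cl (sndCode i))
  · have ha : T.Absorptive := by
      by_contra ha
      exact P.col_abs ha _ hf _ hs hc
    simp only [P.cons_col i hi hi' hc]
    exact (Model.cons_eq_of_head? hT ha (hhead ha _ (hrep hs) _ (hrep hf) hc)).symm
  · exact hcons i hi hi' hc

end ChainSound

/-! ### Reading a bounded pattern off a valuation. -/

theorem map_eq_map_iff_of {α β γ : Type*} {f : α → β} {g : α → γ} {l l' : List α}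
    (h : ∀ a ∈ l, ∀ b ∈ l', f a = f b ↔ g a = g b) : l.map f = l'.map f ↔ l.map g = l'.map g := by
  induction l generalizing l' with
  | nil => cases l' <;> simp
  | cons a l ih =>
    cases l' with
    | nil => simp
    | cons b l' =>
      simp only [List.map_cons, List.cons.injEq]
      rw [h a (by simp) b (by simp),
        ih fun x hx y hy => h x (List.mem_cons_of_mem _ hx) y (List.mem_cons_of_mem _ hy)]

/-- A choice of representatives for an equivalence relation on a set of numbers. -/
theorem exists_representatives (D : ℕ → Prop) (R : ℕ → ℕ → Prop) (hR : Equivalence R) :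
    ∃ c : ℕ → ℕ, (∀ i, D i → D (c i) ∧ R i (c i)) ∧
      (∀ i j, D i → D j → (c i = c j ↔ R i j)) ∧ ∀ i, ¬ D i → c i = 0 := by
  classical
  have hs : ∀ i, D i → D (sInf {j | D j ∧ R i j}) ∧ R i (sInf {j | D j ∧ R i j}) := fun i hi =>
    Nat.sInf_mem (s := {j | D j ∧ R i j}) ⟨i, hi, hR.refl i⟩
  refine ⟨fun i => if D i then sInf {j | D j ∧ R i j} else 0, fun i hi => ?_, fun i j hi hj => ?_,
    fun i hi => if_neg hi⟩
  · beta_reduce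
    rw [if_pos hi]
    exact hs i hi
  · beta_reduce
    rw [if_pos hi, if_pos hj]
    constructor
    · intro e
      exact hR.trans (hs i hi).2 (e ▸ hR.symm (hs j hj).2)
    · intro e
      congr 1
      ext k
      exact and_congr_right fun _ => ⟨fun h => hR.trans (hR.symm e) h, fun h => hR.trans e h⟩

/-- Compression of a strict order to small numbers. -/
theorem exists_rank (B : ℕ) (D : ℕ → Prop) (hD : ∀ i, D i → i < B) {α : Type*} [LinearOrder α]
    (μ : ℕ → α) :
    ∃ rk : ℕ → ℕ, (∀ i j, D i → D j → μ i < μ j → rk i < rk j) ∧ (∀ i, rk i ≤ B) ∧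
      ∀ i, ¬ D i → rk i = 0 := by
  classical
  refine ⟨fun i => if D i then ((Finset.range B).filter fun j => D j ∧ μ j < μ i).card else 0,
    fun i j hi hj hij => ?_, fun i => ?_, fun i hi => if_neg hi⟩
  · simp only [hi, hj, if_true]
    refine Finset.card_lt_card (Finset.ssubset_iff_subset_ne.2 ⟨?_, fun e => ?_⟩)
    · exact Finset.monotone_filter_right _ fun k _ hk => ⟨hk.1, hk.2.trans hij⟩
    · have : i ∈ (Finset.range B).filter fun k => D k ∧ μ k < μ j :=
        Finset.mem_filter.2 ⟨Finset.mem_range.2 (hD i hi), hi, hij⟩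
      rw [← e] at this
      exact lt_irrefl _ (Finset.mem_filter.1 this).2.2
  · beta_reduce
    split_ifs
    · exact (Finset.card_filter_le _ _).trans (Finset.card_range B).le
    · exact Nat.zero_le _

/-- Compression of numbers that keeps zero and the differences equal to one. -/
theorem exists_compress (W : Finset ℕ) :
    ∃ φ : ℕ → ℕ, φ 0 = 0 ∧ φ 1 = 1 ∧ (∀ m ∈ W, m ≠ 0 → φ m ≠ 0) ∧
      (∀ m ∈ W, φ (m + 1) = φ m + 1) ∧ (∀ m ∈ W, ∀ m' ∈ W, φ m = φ m' → m = m') ∧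
      ∀ m ∈ W, φ m ≤ W.card := by
  classical
  -- `φ m` counts the elements of `W ∪ {0}` below `m`. Including `0` forces `φ 1 = 1`.
  let φ : ℕ → ℕ := fun m => ((insert 0 W).filter fun w => w < m).card
  have hsucc : ∀ m ∈ insert 0 W, φ (m + 1) = φ m + 1 := by
    intro m hm
    simp only [φ]
    rw [← Finset.card_insert_of_notMem (a := m) (s := (insert 0 W).filter fun w => w < m) (by simp)]
    congr 1
    ext w
    simp only [Finset.mem_filter, Finset.mem_insert, Nat.lt_succ_iff_lt_or_eq]
    rw [Finset.mem_insert] at hm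
    constructor
    · rintro ⟨h₁, h₂ | h₂⟩ <;> tauto
    · rintro (rfl | ⟨h₁, h₂⟩) <;> tauto
  have hmono : Monotone φ := fun a b hab =>
    Finset.card_le_card (Finset.monotone_filter_right _ fun k _ hk => lt_of_lt_of_le hk hab)
  have h0 : φ 0 = 0 := by simp [φ]
  have h1 : φ 1 = 1 := by
    have := hsucc 0 (by simp)
    rwa [h0] at this
  refine ⟨φ, h0, h1, fun m _ hm => ?_, fun m hm => hsucc m (Finset.mem_insert_of_mem hm),
    fun m hm m' hm' e => ?_, fun m hm => ?_⟩
  · have := hmono (Nat.one_le_iff_ne_zero.2 hm)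
    omega
  · rcases lt_trichotomy m m' with h | h | h
    · have := hmono (Nat.succ_le_of_lt h)
      have := hsucc m (Finset.mem_insert_of_mem hm)
      simp only [Nat.succ_eq_add_one] at *
      omega
    · exact h
    · have := hmono (Nat.succ_le_of_lt h)
      have := hsucc m' (Finset.mem_insert_of_mem hm')
      simp only [Nat.succ_eq_add_one] at *
      omega
  -- For `m ∈ W`, `m` itself is not counted; this compensates for the added `0`.
  · have h₁ : ((insert 0 W).filter fun w => w < m) ⊆ (insert 0 W).erase m := by
      intro w hw
      rw [Finset.mem_filter] at hw
      exact Finset.mem_erase.2 ⟨hw.2.ne, hw.1⟩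
    have h₂ := Finset.card_le_card h₁
    rw [Finset.card_erase_of_mem (Finset.mem_insert_of_mem hm)] at h₂
    have := Finset.card_insert_le 0 W
    simp only [φ]
    omega

section Complete

variable {T : Kind} {F : ℕ → Type u}

/-- Ranks come from depth, components from the equivalence generated by linking `[s | t]` with `t`.
Linked values share the kernel and the multiplicity of everything that is not the value of a subterm
(`hinv`), which yields `ext` and the conditions on kernels. -/
theorem CommPattern.complete (hT : T.Permutative) {B : ℕ} {D : ℕ → Prop}
    {app : ℕ → (ℕ → Model T F) → Model T F} (hI : Interp B D app) {v : ℕ → Model T F}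
    (hv : IsValuation D app v) :
    ∃ (cl rk K : ℕ → ℕ) (cnt : ℕ → ℕ → ℕ), CommPattern T.Absorptive D cl rk K cnt ∧
      (∀ i, cl i ≤ B ∧ rk i ≤ B ∧ K i ≤ B) ∧
      (∀ i, ¬ D i → cl i = 0 ∧ rk i = 0 ∧ K i = 0) ∧
      (∀ i j, cnt i j ≤ B) ∧ (∀ i j, ¬ (D i ∧ D j) → cnt i j = 0) ∧
      (∀ i j, D i → D j → (v i = v j ↔ cl i = cl j)) ∧
      ∀ i j, D i → D j → (Model.Mem (v i) (v j) ↔ cnt (cl i) (cl j) ≠ 0) := by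
  classical
  obtain ⟨cl, hcl, hcl_iff, hcl_zero⟩ := exists_representatives D (fun i j => v i = v j)
    ⟨fun _ => rfl, fun h => h.symm, fun h₁ h₂ => h₁.trans h₂⟩
  let Link : Model T F → Model T F → Prop := fun x y =>
    ∃ i, D i ∧ IsConsCode i ∧ x = v i ∧ y = v (sndCode i)
  obtain ⟨K, hK, hK_iff, hK_zero⟩ := exists_representatives D
    (fun i j => Relation.EqvGen Link (v i) (v j))
    ⟨fun _ => .refl _, fun h => .symm _ _ h, fun h₁ h₂ => .trans _ _ _ h₁ h₂⟩
  obtain ⟨rk, hrk, hrk_le, hrk_zero⟩ := exists_rank B D (fun i => hI.lt) fun i => (v i).dep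
  have hinv : ∀ x y, Relation.EqvGen Link x y → x.ker = y.ker ∧
      ∀ z, (∀ c, D c → z ≠ v c) → Model.cnt z x = Model.cnt z y := by
    intro x y h
    induction h with
    | rel x y h =>
      obtain ⟨i, hi, hi', rfl, rfl⟩ := h
      rw [hv.cons_eq hi hi']
      refine ⟨Model.ker_cons _ _, fun z hz => ?_⟩
      rw [Model.cnt_cons, if_neg (hz _ (hI.fst_mem hi hi'))]
    | refl x => exact ⟨rfl, fun z _ => rfl⟩
    | symm x y _ ih => exact ⟨ih.1.symm, fun z hz => (ih.2 z hz).symm⟩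
    | trans x y z _ _ ih₁ ih₂ =>
      exact ⟨ih₁.1.trans ih₂.1, fun w hw => (ih₁.2 w hw).trans (ih₂.2 w hw)⟩
  -- Compression is done separately for each counted element: no condition compares multiplicities
  -- of different elements.
  let W : ℕ → Finset ℕ := fun c =>
    ((Finset.range B).filter D).image fun j => Model.cnt (v c) (v j)
  have hW : ∀ c i, D i → Model.cnt (v c) (v i) ∈ W c := fun c i hi =>
    Finset.mem_image.2 ⟨i, Finset.mem_filter.2 ⟨Finset.mem_range.2 (hI.lt hi), hi⟩, rfl⟩
  have hWcard : ∀ c, (W c).card ≤ B := fun c =>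
    Finset.card_image_le.trans ((Finset.card_filter_le _ _).trans (Finset.card_range B).le)
  choose φ φ0 φ1 φpos φsucc φinj φle using fun c => exists_compress (W c)
  have hvcl : ∀ {i}, D i → v (cl i) = v i := fun hi => (hcl _ hi).2.symm
  have hDcl : ∀ {i}, D i → D (cl i) := fun hi => (hcl _ hi).1
  let cnt : ℕ → ℕ → ℕ := fun c i => if D c ∧ D i then φ c (Model.cnt (v c) (v i)) else 0
  have hcnt : ∀ {c i}, D c → D i → cnt (cl c) (cl i) = φ (cl c) (Model.cnt (v c) (v i)) := by
    intro c i hc hi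
    simp only [cnt]
    rw [if_pos ⟨hDcl hc, hDcl hi⟩, hvcl hc, hvcl hi]
  have hWcl : ∀ {c i}, D c → D i → Model.cnt (v c) (v i) ∈ W (cl c) := by
    intro c i hc hi
    have := hW (cl c) i hi
    rwa [hvcl hc] at this
  have hcnt_ne : ∀ {c i}, D c → D i → (cnt (cl c) (cl i) ≠ 0 ↔ Model.Mem (v c) (v i)) := by
    intro c i hc hi
    rw [hcnt hc hi, ← Model.cnt_pos]
    constructor
    · intro h
      by_contra h'
      rw [not_lt, Nat.le_zero] at h'
      rw [h', φ0] at h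
      exact h rfl
    · exact fun h => φpos _ _ (hWcl hc hi) h.ne'
  have hKcl : ∀ {i j}, D i → D j → K (cl i) = K (cl j) → Relation.EqvGen Link (v i) (v j) := by
    intro i j hi hj h
    have := (hK_iff _ _ (hDcl hi) (hDcl hj)).1 h
    rwa [hvcl hi, hvcl hj] at this
  refine ⟨cl, rk, K, cnt, ?_, fun i => ⟨?_, hrk_le i, ?_⟩,
    fun i hi => ⟨hcl_zero i hi, hrk_zero i hi, hK_zero i hi⟩, fun i j => ?_,
    fun i j h => if_neg h, fun i j hi hj => (hcl_iff i j hi hj).symm,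
    fun i j hi hj => (hcnt_ne hi hj).symm⟩
  · constructor
    · exact fun i hi => ⟨hDcl hi, (hcl_iff _ _ (hDcl hi) hi).2 (hvcl hi)⟩
    · intro i hi hi' j hj hj'
      rw [hcl_iff i j hi hj, hv.app_eq hi hi', hv.app_eq hj hj', hI.app_eq_iff hi hi' hj hj']
      exact and_congr_right fun _ => map_eq_map_iff_of fun a ha b hb =>
        (hcl_iff a b (hI.arg_mem hi hi' ha) (hI.arg_mem hj hj' hb)).symm
    · intro i hi hi' a ha j hj hKj
      have hDa := hI.arg_mem hi hi' ha
      refine hrk _ _ (hDcl hDa) (hDcl hj) ?_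
      rw [hvcl hDa, hvcl hj]
      -- Every value of the component has the kernel `f(…)`, which is deeper than its arguments and
      -- no deeper than the value itself.
      have h₁ := (hinv _ _ (hKcl hj hi hKj)).1
      have h₂ := hI.dep_lt hi hi' v ha
      have h₃ := Model.dep_ker_le (v j)
      rw [h₁, hv.app_eq hi hi', hI.ker_app hi hi'] at h₃
      omega
    · intro i hi hi' j hj hj' hKij
      have h₁ := (hinv _ _ (hKcl hi hj hKij)).1
      rw [hcl_iff i j hi hj]
      rw [hv.app_eq hi hi', hv.app_eq hj hj', hI.ker_app hi hi', hI.ker_app hj hj'] at h₁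
      rw [hv.app_eq hi hi', hv.app_eq hj hj', h₁]
    · intro i hi hi' c hc
      rw [hcnt hc hi, hv.app_eq hi hi', hI.cnt_app hi hi', φ0]
    · intro i hi hi'
      have hs := hI.snd_mem hi hi'
      rw [hK_iff _ _ (hDcl hi) (hDcl hs), hvcl hi, hvcl hs]
      exact .rel _ _ ⟨i, hi, hi', rfl, rfl⟩
    · intro i hi hi' c hc hne
      have hs := hI.snd_mem hi hi'
      rw [ne_eq, hcl_iff _ _ hc (hI.fst_mem hi hi')] at hne
      rw [hcnt hc hi, hcnt hc hs, hv.cons_eq hi hi', Model.cnt_cons, if_neg hne]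
    · intro ha i hi hi' c hc he
      have hs := hI.snd_mem hi hi'
      rw [hcl_iff _ _ hc (hI.fst_mem hi hi')] at he
      rw [hcnt hc hi, hcnt hc hs, hv.cons_eq hi hi', Model.cnt_cons, if_pos he, if_neg ha,
        φsucc _ _ (hWcl hc hs)]
    · intro ha i hi hi' c hc he
      rw [hcl_iff _ _ hc (hI.fst_mem hi hi')] at he
      rw [hcnt hc hi, hv.cons_eq hi hi', Model.cnt_cons, if_pos he, if_pos ha, φ1]
    · intro ha c hc i hi
      rw [hcnt hc hi]
      have := Model.cnt_le_one ha (v c) (v i)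
      interval_cases h : Model.cnt (v c) (v i)
      · rw [φ0]
        exact Nat.zero_le _
      · rw [φ1]
    · intro c hc i hi h
      refine hrk _ _ (hDcl hc) (hDcl hi) ?_
      rw [hvcl hc, hvcl hi]
      exact Model.dep_lt_of_mem ((hcnt_ne hc hi).1 h)
    · intro i hi j hj hKij h
      obtain ⟨h₁, h₂⟩ := hinv _ _ (hKcl hi hj hKij)
      rw [hcl_iff i j hi hj]
      refine Model.ext_cnt hT (fun z => ?_) h₁
      by_cases hz : ∃ c, D c ∧ z = v c
      · obtain ⟨c, hc, rfl⟩ := hz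
        have := h c hc
        rw [hcnt hc hi, hcnt hc hj] at this
        exact φinj _ _ (hWcl hc hi) _ (hWcl hc hj) this
      · exact h₂ z fun c hc e => hz ⟨c, hc, e⟩
  · by_cases hi : D i
    · exact (hI.lt (hDcl hi)).le
    · rw [hcl_zero i hi]
      exact Nat.zero_le _
  · by_cases hi : D i
    · exact (hI.lt (hK i hi).1).le
    · rw [hK_zero i hi]
      exact Nat.zero_le _
  · simp only [cnt]
    split_ifs with h
    · exact (φle _ _ (hW i j h.2)).trans (hWcard i)
    · exact Nat.zero_le _

theorem ChainPattern.complete (hT : ¬ T.Permutative) {B : ℕ} {D : ℕ → Prop}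
    {app : ℕ → (ℕ → Model T F) → Model T F} (hI : Interp B D app) {v : ℕ → Model T F}
    (hv : IsValuation D app v) :
    ∃ (cl rk : ℕ → ℕ) (M Col : ℕ → ℕ → Prop), ChainPattern T.Absorptive D cl rk M Col ∧
      (∀ i, cl i ≤ B ∧ rk i ≤ B) ∧ (∀ i, ¬ D i → cl i = 0 ∧ rk i = 0) ∧
      (∀ i j, M i j → D i ∧ D j) ∧ (∀ i j, Col i j → D i ∧ D j) ∧
      (∀ i j, D i → D j → (v i = v j ↔ cl i = cl j)) ∧
      ∀ i j, D i → D j → (Model.Mem (v i) (v j) ↔ M (cl i) (cl j)) := by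
  classical
  obtain ⟨cl, hcl, hcl_iff, hcl_zero⟩ := exists_representatives D (fun i j => v i = v j)
    ⟨fun _ => rfl, fun h => h.symm, fun h₁ h₂ => h₁.trans h₂⟩
  -- A non-collapsing `[a | b]` can have the same depth as `b`; its larger number of elements breaks
  -- the tie.
  obtain ⟨rk, hrk, hrk_le, hrk_zero⟩ := exists_rank B D (fun i => hI.lt)
    fun i => toLex ((v i).dep, (v i).elts.length)
  have hvcl : ∀ {i}, D i → v (cl i) = v i := fun hi => (hcl _ hi).2.symm
  have hDcl : ∀ {i}, D i → D (cl i) := fun hi => (hcl _ hi).1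
  have hrk' : ∀ {i j}, D i → D j → ((v i).dep < (v j).dep ∨
      (v i).dep ≤ (v j).dep ∧ (v i).elts.length < (v j).elts.length) → rk (cl i) < rk (cl j) := by
    intro i j hi hj h
    refine hrk _ _ (hDcl hi) (hDcl hj) ?_
    rw [hvcl hi, hvcl hj, Prod.Lex.toLex_lt_toLex]
    simp only
    omega
  let M : ℕ → ℕ → Prop := fun i j => (D i ∧ D j) ∧ Model.Mem (v i) (v j)
  let Col : ℕ → ℕ → Prop := fun i j =>
    (D i ∧ D j) ∧ T.Absorptive ∧ (v j).elts.head? = some (v i)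
  have hM : ∀ {i j}, D i → D j → (M (cl i) (cl j) ↔ Model.Mem (v i) (v j)) := by
    intro i j hi hj
    simp only [M, hDcl hi, hDcl hj, hvcl hi, hvcl hj, true_and]
  have hCol : ∀ {i j}, D i → D j →
      (Col (cl i) (cl j) ↔ T.Absorptive ∧ (v j).elts.head? = some (v i)) := by
    intro i j hi hj
    simp only [Col, hDcl hi, hDcl hj, hvcl hi, hvcl hj, true_and]
  have hproper : ∀ {i}, D i → IsConsCode i → ¬ Col (cl (fstCode i)) (cl (sndCode i)) →
      (v i).elts = v (fstCode i) :: (v (sndCode i)).elts := by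
    intro i hi hi' hc
    rw [hCol (hI.fst_mem hi hi') (hI.snd_mem hi hi')] at hc
    rw [hv.cons_eq hi hi', Model.elts_cons hT, if_neg hc]
  refine ⟨cl, rk, M, Col, ?_, fun i => ⟨?_, hrk_le i⟩,
    fun i hi => ⟨hcl_zero i hi, hrk_zero i hi⟩, fun i j h => h.1, fun i j h => h.1,
    fun i j hi hj => (hcl_iff i j hi hj).symm, fun i j hi hj => (hM hi hj).symm⟩
  · constructor
    · exact fun i hi => ⟨hDcl hi, (hcl_iff _ _ (hDcl hi) hi).2 (hvcl hi)⟩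
    · intro i hi hi' j hj hj'
      rw [hcl_iff i j hi hj, hv.app_eq hi hi', hv.app_eq hj hj', hI.app_eq_iff hi hi' hj hj']
      exact and_congr_right fun _ => map_eq_map_iff_of fun a ha b hb =>
        (hcl_iff a b (hI.arg_mem hi hi' ha) (hI.arg_mem hj hj' hb)).symm
    · intro i hi hi' a ha
      refine hrk' (hI.arg_mem hi hi' ha) hi (Or.inl ?_)
      rw [hv.app_eq hi hi']
      exact hI.dep_lt hi hi' v ha
    · intro i hi hi' c hc
      rw [hM hc hi, hv.app_eq hi hi']
      exact hI.not_mem_app hi hi' _ _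
    · intro i hi hi' j hj hj'
      rw [ne_eq, hcl_iff i j hi hj, hv.app_eq hi hi', hv.cons_eq hj hj']
      exact hI.app_ne_cons hi hi' _ _ _
    · intro ha c hc i hi
      rw [hCol hc hi]
      exact fun h => ha h.1
    · intro c hc i hi
      rw [hCol hc hi, hM hc hi]
      exact fun h => (Model.mem_elts hT).1 (List.mem_of_head? h.2)
    · intro c hc d hd i hi
      rw [hCol hc hi, hCol hd hi, hcl_iff c d hc hd]
      rintro ⟨-, h₁⟩ ⟨-, h₂⟩
      rwa [h₁, Option.some_inj] at h₂
    · intro i hi hi' hc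
      rw [hCol (hI.fst_mem hi hi') (hI.snd_mem hi hi')] at hc
      rw [hcl_iff _ _ hi (hI.snd_mem hi hi'), hv.cons_eq hi hi']
      exact Model.cons_eq_of_head? hT hc.1 hc.2
    · intro i hi hi' hc
      have he := hproper hi hi' hc
      constructor
      · refine hrk' (hI.fst_mem hi hi') hi (Or.inl ?_)
        rw [hv.cons_eq hi hi', Model.dep_cons]
        omega
      · refine hrk' (hI.snd_mem hi hi') hi (Or.inr ⟨?_, ?_⟩)
        · rw [hv.cons_eq hi hi', Model.dep_cons]
          omega
        · rw [he, List.length_cons]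
          omega
    · intro i hi hi' hci j hj hj' hcj
      rw [hcl_iff i j hi hj, hcl_iff _ _ (hI.fst_mem hi hi') (hI.fst_mem hj hj'),
        hcl_iff _ _ (hI.snd_mem hi hi') (hI.snd_mem hj hj')]
      constructor
      · intro e
        have e₁ := congrArg Model.elts e
        have e₂ := congrArg Model.ker e
        rw [hproper hi hi' hci, hproper hj hj' hcj, List.cons.injEq] at e₁
        rw [hv.cons_eq hi hi', hv.cons_eq hj hj', Model.ker_cons, Model.ker_cons] at e₂
        exact ⟨e₁.1, Model.ext_elts hT e₁.2 e₂⟩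
      · rintro ⟨e₁, e₂⟩
        rw [hv.cons_eq hi hi', hv.cons_eq hj hj', e₁, e₂]
    · intro i hi hi' hci c hc
      rw [hM hc hi, hM hc (hI.snd_mem hi hi'), hcl_iff _ _ hc (hI.fst_mem hi hi'),
        hv.cons_eq hi hi', Model.mem_cons]
    · intro ha i hi hi' hci c hc
      rw [hCol hc hi, hproper hi hi' hci, hcl_iff _ _ hc (hI.fst_mem hi hi'), List.head?_cons,
        Option.some_inj, eq_comm (a := v (fstCode i))]
      exact and_iff_right ha
    · intro c hc i hi h
      rw [hM hc hi] at h
      exact hrk' hc hi (Or.inl (Model.dep_lt_of_mem h))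
  · by_cases hi : D i
    · exact (hI.lt (hDcl hi)).le
    · rw [hcl_zero i hi]
      exact Nat.zero_le _

end Complete

/-! Constraints and their codes. -/

theorem lt_encode_of_mem {a : ℕ} {l : List ℕ} (h : a ∈ l) : a < Encodable.encode l := by
  induction l with
  | nil => simp at h
  | cons b l ih =>
    rw [Encodable.encode_list_cons, Nat.lt_succ_iff]
    rcases List.mem_cons.1 h with rfl | h
    · exact Nat.left_le_pair a _
    · exact (ih h).le.trans (Nat.right_le_pair _ _)

theorem lt_of_mem_argCodes {i a : ℕ} (h : a ∈ argCodes i) : a < i := by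
  refine (lt_encode_of_mem h).trans_le ?_
  rw [argCodes, Denumerable.encode_ofNat]
  exact (Nat.unpair_right_le _).trans (Nat.unpair_right_le _)

/-- The codes of the two sides of a literal. -/
def leftCode (l : ℕ) : ℕ := l.unpair.2.unpair.1

def rightCode (l : ℕ) : ℕ := l.unpair.2.unpair.2

/-- The codes of the subterms of a constraint. -/
inductive SubCode (c : List ℕ) : ℕ → Prop
  | left {l : ℕ} : l ∈ c → SubCode c (leftCode l)
  | right {l : ℕ} : l ∈ c → SubCode c (rightCode l)
  | arg {i a : ℕ} : SubCode c i → i.unpair.1 = 1 → a ∈ argCodes i → SubCode c a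

theorem SubCode.lt {c : List ℕ} {i : ℕ} (h : SubCode c i) : i < Encodable.encode c := by
  induction h with
  | left hl =>
    exact ((Nat.unpair_left_le _).trans (Nat.unpair_right_le _)).trans_lt (lt_encode_of_mem hl)
  | right hl =>
    exact ((Nat.unpair_right_le _).trans (Nat.unpair_right_le _)).trans_lt (lt_encode_of_mem hl)
  | arg _ _ ha ih => exact (lt_of_mem_argCodes ha).trans ih

/-- The condition that determines the codes of subterms among the numbers less than `B`. -/
def SubPattern (c : List ℕ) (B : ℕ) (D : ℕ → Prop) : Prop :=
  ∀ i < B, D i ↔ (∃ l ∈ c, leftCode l = i ∨ rightCode l = i) ∨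
    ∃ j < B, D j ∧ j.unpair.1 = 1 ∧ ∃ a ∈ argCodes j, a = i

/-- Arguments have smaller codes than their terms, so membership of `i` depends only on larger
numbers. Descending induction from `B` shows that the fixed-point condition has a single solution
below `B`. -/
theorem SubPattern.iff_subCode {c : List ℕ} {B : ℕ} {D : ℕ → Prop} (hB : Encodable.encode c ≤ B)
    (h : SubPattern c B D) {i : ℕ} (hi : i < B) : D i ↔ SubCode c i := by
  constructor
  · have key : ∀ n, ∀ i, i < B → B - i ≤ n → D i → SubCode c i := by
      intro n
      induction n with
      | zero => intro i hi hn; omega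
      | succ n ih =>
        intro i hi hn hD
        rcases (h i hi).1 hD with ⟨l, hl, rfl | rfl⟩ | ⟨j, hj, hDj, hj1, a, ha, rfl⟩
        · exact .left hl
        · exact .right hl
        · have := lt_of_mem_argCodes ha
          exact .arg (ih j hj (by omega) hDj) hj1 ha
    exact key _ i hi le_rfl
  · intro hs
    induction hs with
    | left hl => exact (h _ hi).2 (Or.inl ⟨_, hl, Or.inl rfl⟩)
    | right hl => exact (h _ hi).2 (Or.inl ⟨_, hl, Or.inr rfl⟩)
    | arg hj hj1 ha ih =>
      have := hj.lt.trans_le hB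
      exact (h _ hi).2 (Or.inr ⟨_, this, ih this, hj1, _, ha, rfl⟩)

theorem subPattern_subCode {c : List ℕ} {B : ℕ} (hB : Encodable.encode c ≤ B) :
    SubPattern c B (SubCode c) := by
  intro i _
  constructor
  · intro h
    cases h with
    | left hl => exact Or.inl ⟨_, hl, Or.inl rfl⟩
    | right hl => exact Or.inl ⟨_, hl, Or.inr rfl⟩
    | arg hj hj1 ha => exact Or.inr ⟨_, hj.lt.trans_le hB, hj, hj1, _, ha, rfl⟩
  · rintro (⟨l, hl, rfl | rfl⟩ | ⟨j, hj, hDj, hj1, a, ha, rfl⟩)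
    · exact .left hl
    · exact .right hl
    · exact .arg hDj hj1 ha

/-- The literal with number `l` holds for the given relations of equality and membership. -/
def LitHolds (E M : ℕ → ℕ → Prop) (l : ℕ) : Prop :=
  (l.unpair.1 = 0 → E (leftCode l) (rightCode l)) ∧
  (l.unpair.1 = 1 → ¬ E (leftCode l) (rightCode l)) ∧
  (l.unpair.1 = 2 → M (leftCode l) (rightCode l)) ∧
  (l.unpair.1 = 3 → ¬ M (leftCode l) (rightCode l))

theorem LitHolds.congr {E M E' M' : ℕ → ℕ → Prop} {l : ℕ}
    (hE : E (leftCode l) (rightCode l) ↔ E' (leftCode l) (rightCode l))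
    (hM : M (leftCode l) (rightCode l) ↔ M' (leftCode l) (rightCode l)) :
    LitHolds E M l ↔ LitHolds E' M' l := by
  unfold LitHolds
  rw [hE, hM]

/-! ### Terms and their numbers. -/

section Codes

variable {T : Kind} {F : ℕ → Type u} {ν : ∀ n, F n → ℕ}

@[elab_as_elim]
theorem Tm.ind {α : Type} {p : Tm F α → Prop}
    (var : ∀ i, p (FirstOrder.Language.Term.var i))
    (func : ∀ (n : ℕ) (f : Fun F n) (ts : Fin n → Tm F α), (∀ k, p (ts k)) →
      p (FirstOrder.Language.Term.func (L := lang F) f ts)) (t : Tm F α) : p t := by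
  induction t with
  | var i => exact var i
  | func f ts ih => exact func _ f ts ih

/-- The interpretation of the head symbol of the term `dec i`, the arguments being given through
their codes. -/
noncomputable def codeApp (T : Kind) (ν : ∀ n, F n → ℕ) (dec : ℕ → Tm F ℕ) (i : ℕ)
    (x : ℕ → Model T F) : Model T F :=
  match dec i with
  | .var _ => Model.nil
  | .func f ts => Model.app f fun k => x (termCode ν (ts k))

theorem unpair_termCode_var (i : ℕ) :
    (termCode ν (FirstOrder.Language.Term.var i : Tm F ℕ)).unpair.1 = 0 := by
  simp [termCode]

theorem unpair_termCode_func {n : ℕ} (f : Fun F n) (ts : Fin n → Tm F ℕ) :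
    (termCode ν (FirstOrder.Language.Term.func (L := lang F) f ts)).unpair.1 = 1 := by
  simp [termCode]

theorem headCode_termCode {n : ℕ} (f : Fun F n) (ts : Fin n → Tm F ℕ) :
    headCode (termCode ν (FirstOrder.Language.Term.func (L := lang F) f ts)) = Fun.code ν f := by
  simp [termCode, headCode]

theorem argCodes_termCode {n : ℕ} (f : Fun F n) (ts : Fin n → Tm F ℕ) :
    argCodes (termCode ν (FirstOrder.Language.Term.func (L := lang F) f ts)) =
      List.ofFn fun i => termCode ν (ts i) := by
  simp [termCode, argCodes]

theorem Fun.code_eq_cons_iff {n : ℕ} (f : Fun F n) : Fun.code ν f = Nat.pair 1 0 ↔ f.IsCons := by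
  cases f <;> simp [Fun.code, Fun.IsCons, Nat.pair_eq_pair]

theorem Fun.code_inj {C : Constraint F} (hν : C.Naming ν) {n : ℕ} {f g : Fun F n}
    (hf : f.others ⊆ C.symbols) (hg : g.others ⊆ C.symbols) (h : Fun.code ν f = Fun.code ν g) :
    f = g := by
  cases f with
  | nil => cases g with
    | nil => rfl
    | other g => simp [Fun.code, Nat.pair_eq_pair] at h
  | cons => cases g with
    | cons => rfl
    | other g => simp [Fun.code, Nat.pair_eq_pair] at h
  | other f => cases g with
    | nil => simp [Fun.code, Nat.pair_eq_pair] at h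
    | cons => simp [Fun.code, Nat.pair_eq_pair] at h
    | other g =>
      simp only [Fun.code, Nat.pair_eq_pair, true_and] at h
      rw [hν n (hf rfl) (hg rfl) h]

theorem termCode_inj {C : Constraint F} (hν : C.Naming ν) {s t : Tm F ℕ}
    (hs : termSymbols s ⊆ C.symbols) (ht : termSymbols t ⊆ C.symbols)
    (h : termCode ν s = termCode ν t) : s = t := by
  induction s generalizing t with
  | var i =>
    cases t with
    | var j =>
      simp only [termCode, Nat.pair_eq_pair, true_and] at h
      rw [h]
    | func g us => simp [termCode, Nat.pair_eq_pair] at h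
  | func f ss ih =>
    cases t with
    | var j => simp [termCode, Nat.pair_eq_pair] at h
    | func g us =>
      simp only [termCode, Nat.pair_eq_pair, true_and, Encodable.encode_inj] at h
      obtain ⟨h₁, h₂⟩ := h
      have hlen : _ = _ := congrArg List.length h₂
      rw [List.length_ofFn, List.length_ofFn] at hlen
      subst hlen
      have h₂' := List.ofFn_injective h₂
      simp only [termSymbols, Set.union_subset_iff, Set.iUnion_subset_iff] at hs ht
      have e : f = g := Fun.code_inj hν hs.1 ht.1 h₁
      subst e
      congr 1
      funext i
      exact ih i (hs.2 i) (ht.2 i) (congrFun h₂' i)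

theorem SubCode.exists_term {C : Constraint F} {i : ℕ} (h : SubCode (C.code ν) i) :
    ∃ t : Tm F ℕ, termSymbols t ⊆ C.symbols ∧ termCode ν t = i := by
  have hlit : ∀ l ∈ C, l.symbols ⊆ C.symbols := fun l hl =>
    Set.subset_biUnion_of_mem (u := fun l : Literal F => l.symbols) hl
  induction h with
  | left hl =>
    obtain ⟨l, hl', rfl⟩ := List.mem_map.1 hl
    have := hlit l hl'
    cases l with
    | _ s t =>
      refine ⟨s, Set.subset_union_left.trans this, ?_⟩
      simp [leftCode, Literal.code]
  | right hl =>
    obtain ⟨l, hl', rfl⟩ := List.mem_map.1 hl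
    have := hlit l hl'
    cases l with
    | _ s t =>
      refine ⟨t, Set.subset_union_right.trans this, ?_⟩
      simp [rightCode, Literal.code]
  | arg _ hi ha ih =>
    obtain ⟨t, ht, rfl⟩ := ih
    cases t using Tm.ind with
    | var i =>
      rw [unpair_termCode_var] at hi
      omega
    | func n f ts =>
      rw [argCodes_termCode, List.mem_ofFn] at ha
      obtain ⟨k, rfl⟩ := ha
      simp only [termSymbols, Set.union_subset_iff, Set.iUnion_subset_iff] at ht
      exact ⟨ts k, ht.2 k, rfl⟩

theorem codeApp_view {C : Constraint F} {dec : ℕ → Tm F ℕ}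
    (hdec : ∀ i, SubCode (C.code ν) i → termSymbols (dec i) ⊆ C.symbols ∧ termCode ν (dec i) = i)
    {i : ℕ} (hi : SubCode (C.code ν) i) (hi' : IsAppCode i) :
    ∃ (n : ℕ) (f : Fun F n) (ts : Fin n → Tm F ℕ), ¬ f.IsCons ∧ f.others ⊆ C.symbols ∧
      headCode i = Fun.code ν f ∧ argCodes i = List.ofFn (fun k => termCode ν (ts k)) ∧
      dec i = FirstOrder.Language.Term.func (L := lang F) f ts ∧
      ∀ x, codeApp T ν dec i x = Model.app f fun k => x (termCode ν (ts k)) := by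
  obtain ⟨h₁, h₂⟩ := hdec i hi
  cases hd : dec i using Tm.ind with
  | var j =>
    rw [hd] at h₂
    have := hi'.1
    rw [← h₂, unpair_termCode_var] at this
    omega
  | func n f ts =>
    rw [hd] at h₁ h₂
    simp only [termSymbols, Set.union_subset_iff] at h₁
    have hh : headCode i = Fun.code ν f := by rw [← h₂]; exact headCode_termCode f ts
    refine ⟨n, f, ts, ?_, h₁.1, hh, by rw [← h₂]; exact argCodes_termCode f ts, rfl, fun x => ?_⟩
    · rw [← Fun.code_eq_cons_iff (ν := ν)]
      exact fun e => hi'.2 (hh.trans e)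
    · unfold codeApp
      rw [hd]

theorem dec_cons {C : Constraint F} {dec : ℕ → Tm F ℕ}
    (hdec : ∀ i, SubCode (C.code ν) i → termSymbols (dec i) ⊆ C.symbols ∧ termCode ν (dec i) = i)
    {i : ℕ} (hi : SubCode (C.code ν) i) (hi' : IsConsCode i) :
    ∃ s t : Tm F ℕ, dec i = consT s t ∧ argCodes i = [termCode ν s, termCode ν t] ∧
      fstCode i = termCode ν s ∧ sndCode i = termCode ν t := by
  obtain ⟨h₁, h₂⟩ := hdec i hi
  cases hd : dec i using Tm.ind with
  | var j =>
    rw [hd] at h₂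
    have := hi'.1
    rw [← h₂, unpair_termCode_var] at this
    omega
  | func n f ts =>
    rw [hd] at h₁ h₂
    have hh : headCode i = Fun.code ν f := by rw [← h₂]; exact headCode_termCode f ts
    have hc : Fun.IsCons f := (Fun.code_eq_cons_iff (ν := ν) f).1 (hh.symm.trans hi'.2)
    cases f with
    | nil => exact hc.elim
    | other f => exact hc.elim
    | cons =>
      have ha : argCodes i = [termCode ν (ts 0), termCode ν (ts 1)] := by
        rw [← h₂]
        refine (argCodes_termCode (Fun.cons : Fun F 2) ts).trans ?_
        rw [List.ofFn_succ, List.ofFn_succ, List.ofFn_zero]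
        rfl
      refine ⟨ts 0, ts 1, ?_, ha, by rw [fstCode, ha]; rfl, by rw [sndCode, ha]; rfl⟩
      unfold consT
      congr 1
      funext k
      fin_cases k <;> rfl

/-- `Naming` makes head numbers as good as symbols: on the symbols of `C`, equal numbers and arities
mean equal symbols, and symbols other than `cons` act freely. -/
theorem interp_codeApp {C : Constraint F} (hν : C.Naming ν) {dec : ℕ → Tm F ℕ}
    (hdec : ∀ i, SubCode (C.code ν) i →
      termSymbols (dec i) ⊆ C.symbols ∧ termCode ν (dec i) = i) :
    Interp (Encodable.encode (C.code ν)) (SubCode (C.code ν)) (codeApp T ν dec) where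
  lt := fun h => h.lt
  fst_mem := fun {i} hi hi' => by
    obtain ⟨s, t, -, ha, hf, -⟩ := dec_cons hdec hi hi'
    exact .arg hi hi'.1 (by rw [ha, hf]; simp)
  snd_mem := fun {i} hi hi' => by
    obtain ⟨s, t, -, ha, -, hs⟩ := dec_cons hdec hi hi'
    exact .arg hi hi'.1 (by rw [ha, hs]; simp)
  arg_mem := fun hi hi' _ ha => .arg hi hi'.1 ha
  app_eq_iff := fun {i j} hi hi' hj hj' x y => by
    obtain ⟨n, f, ts, hf, hfC, hfh, hfa, -, hfx⟩ := codeApp_view (T := T) hdec hi hi'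
    obtain ⟨m, g, us, hg, hgC, hgh, hga, -, hgx⟩ := codeApp_view (T := T) hdec hj hj'
    rw [hfx, hgx, hfh, hgh, hfa, hga, List.map_ofFn, List.map_ofFn]
    constructor
    · intro e
      have e' := Model.app_inj hf hg e
      simp only [Sigma.mk.injEq] at e'
      obtain ⟨rfl, e'⟩ := e'
      rw [heq_eq_eq, Prod.mk.injEq] at e'
      exact ⟨by rw [e'.1], congrArg List.ofFn e'.2⟩
    · rintro ⟨e₁, e₂⟩
      have hlen := congrArg List.length e₂
      rw [List.length_ofFn, List.length_ofFn] at hlen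
      subst hlen
      rw [Fun.code_inj hν hfC hgC e₁]
      exact congrArg _ (List.ofFn_injective e₂)
  exists_app := fun {i} hi hi' x => by
    obtain ⟨n, f, ts, hf, -, -, -, -, hfx⟩ := codeApp_view (T := T) hdec hi hi'
    exact ⟨n, f, _, hf, hfx x⟩
  dep_lt := fun {i} hi hi' x a ha => by
    obtain ⟨n, f, ts, hf, -, -, hfa, -, hfx⟩ := codeApp_view (T := T) hdec hi hi'
    rw [hfa, List.mem_ofFn] at ha
    obtain ⟨k, rfl⟩ := ha
    rw [hfx, Model.dep_app hf, Nat.lt_succ_iff]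
    exact Finset.le_sup (f := fun k => (x (termCode ν (ts k))).dep) (Finset.mem_univ k)
  dep_le := fun {i} hi hi' x m h => by
    obtain ⟨n, f, ts, hf, -, -, hfa, -, hfx⟩ := codeApp_view (T := T) hdec hi hi'
    rw [hfx, Model.dep_app hf, Nat.succ_le_succ_iff]
    refine Finset.sup_le fun k _ => h _ ?_
    rw [hfa, List.mem_ofFn]
    exact ⟨k, rfl⟩

/-- The truth of a literal, in terms of the values of its two sides. -/
theorem Literal.realize_iff (l : Literal F) (σ : ℕ → Model T F) (v : ℕ → Model T F)
    (hv : ∀ t : Tm F ℕ, (termCode ν t = leftCode (l.code ν) ∨ termCode ν t = rightCode (l.code ν)) →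
      termSymbols t ⊆ l.symbols → t.realize σ = v (termCode ν t)) :
    l.toFormula.Realize σ ↔
      LitHolds (fun i j => v i = v j) (fun i j => Model.Mem (v i) (v j)) (l.code ν) := by
  have hmem : ∀ s t : Tm F ℕ, (memFormula s t).Realize σ ↔
      Model.Mem (s.realize σ) (t.realize σ) := by
    intro s t
    exact FirstOrder.Language.Formula.realize_rel₂ (L := lang F) (R := (Pred.mem : Pred 2))
  have heq : ∀ s t : Tm F ℕ, (FirstOrder.Language.Term.equal s t).Realize σ ↔
      s.realize σ = t.realize σ := fun s t => FirstOrder.Language.Formula.realize_equal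
  have hnot : ∀ φ : (lang F).Formula ℕ,
      FirstOrder.Language.Formula.Realize (FirstOrder.Language.BoundedFormula.not φ) σ ↔
        ¬ φ.Realize σ := fun φ => FirstOrder.Language.Formula.realize_not
  cases l with
  | _ s t =>
    have hs := hv s (by simp [leftCode, Literal.code]) Set.subset_union_left
    have ht := hv t (by simp [rightCode, Literal.code]) Set.subset_union_right
    simp [Literal.toFormula, LitHolds, leftCode, rightCode, Literal.code, hmem, heq, hnot, hs, ht]

/-- A satisfying assignment restricts to the subterms. Conversely, giving each variable the value of
its code makes every subterm evaluate to the value of its own code, by induction on terms. Beyond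
this point only numbers matter. -/
theorem exists_interp_satisfiable_iff (T : Kind) {C : Constraint F} (hν : C.Naming ν) :
    ∃ app : ℕ → (ℕ → Model T F) → Model T F,
      Interp (Encodable.encode (C.code ν)) (SubCode (C.code ν)) app ∧
      (C.Satisfiable T ↔ ∃ v, IsValuation (SubCode (C.code ν)) app v ∧ ∀ l ∈ C.code ν,
        LitHolds (fun i j => v i = v j) (fun i j => Model.Mem (v i) (v j)) l) := by
  classical
  have h : ∀ i, ∃ t : Tm F ℕ, SubCode (C.code ν) i →
      termSymbols t ⊆ C.symbols ∧ termCode ν t = i := by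
    intro i
    by_cases hi : SubCode (C.code ν) i
    · obtain ⟨t, ht⟩ := hi.exists_term
      exact ⟨t, fun _ => ht⟩
    · exact ⟨.var 0, fun hi' => (hi hi').elim⟩
  choose dec hdec using h
  -- A number has at most one decoding over the symbols of `C`, so `dec` recovers the actual
  -- subterm.
  have hdec' : ∀ t : Tm F ℕ, SubCode (C.code ν) (termCode ν t) → termSymbols t ⊆ C.symbols →
      dec (termCode ν t) = t := fun t ht hs =>
    termCode_inj hν (hdec _ ht).1 hs (hdec _ ht).2
  have hlit : ∀ l ∈ C, l.symbols ⊆ C.symbols := fun l hl =>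
    Set.subset_biUnion_of_mem (u := fun l : Literal F => l.symbols) hl
  have hside : ∀ l ∈ C, ∀ t : Tm F ℕ,
      (termCode ν t = leftCode (l.code ν) ∨ termCode ν t = rightCode (l.code ν)) →
      SubCode (C.code ν) (termCode ν t) := by
    rintro l hl t (e | e) <;> rw [e]
    · exact .left (List.mem_map_of_mem hl)
    · exact .right (List.mem_map_of_mem hl)
  refine ⟨codeApp T ν dec, interp_codeApp hν hdec, ?_, ?_⟩
  · rintro ⟨σ, hσ⟩
    have hval : ∀ t : Tm F ℕ, SubCode (C.code ν) (termCode ν t) → termSymbols t ⊆ C.symbols →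
        t.realize σ = (dec (termCode ν t)).realize σ := fun t ht hs => by rw [hdec' t ht hs]
    refine ⟨fun i => (dec i).realize σ, ⟨fun {i} hi hi' => ?_, fun {i} hi hi' => ?_⟩, fun l hl => ?_⟩
    · obtain ⟨n, f, ts, hf, -, -, hfa, hd, hfx⟩ := codeApp_view (T := T) hdec hi hi'
      have hsym := (hdec i hi).1
      rw [hd] at hsym
      simp only [termSymbols, Set.union_subset_iff, Set.iUnion_subset_iff] at hsym
      rw [hfx, hd]
      refine congrArg (Model.app f) (funext fun k => hval _ ?_ (hsym.2 k))
      exact .arg hi hi'.1 (by rw [hfa, List.mem_ofFn]; exact ⟨k, rfl⟩)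
    · obtain ⟨s, t, hd, ha, hs, ht⟩ := dec_cons hdec hi hi'
      have hsym := (hdec i hi).1
      rw [hd] at hsym
      simp only [consT, termSymbols, Set.union_subset_iff, Set.iUnion_subset_iff,
        Fin.forall_fin_two] at hsym
      have h₁ := hval s (.arg hi hi'.1 (by rw [ha]; simp)) hsym.2.1
      have h₂ := hval t (.arg hi hi'.1 (by rw [ha]; simp)) hsym.2.2
      rw [hd, hs, ht, ← h₁, ← h₂]
      exact Model.app_cons _
    · obtain ⟨l, hl', rfl⟩ := List.mem_map.1 hl
      exact (l.realize_iff σ _ fun t ht hs =>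
        hval t (hside l hl' t ht) (hs.trans (hlit l hl'))).1 (hσ l hl')
  · rintro ⟨v, hv, hvl⟩
    have hval : ∀ t : Tm F ℕ, SubCode (C.code ν) (termCode ν t) → termSymbols t ⊆ C.symbols →
        t.realize (fun n => v (termCode ν (.var n : Tm F ℕ))) = v (termCode ν t) := by
      intro t
      induction t using Tm.ind with
      | var n => exact fun _ _ => rfl
      | func n f ts ih =>
        intro ht hs
        have hd := hdec' _ ht hs
        have hsub := hs
        simp only [termSymbols, Set.union_subset_iff, Set.iUnion_subset_iff] at hsub
        have h1 := unpair_termCode_func (ν := ν) f ts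
        have harg := argCodes_termCode (ν := ν) f ts
        have ih' : (fun k => (ts k).realize fun n => v (termCode ν (.var n : Tm F ℕ))) =
            fun k => v (termCode ν (ts k)) := funext fun k =>
          ih k (.arg ht h1 (by rw [harg, List.mem_ofFn]; exact ⟨k, rfl⟩)) (hsub.2 k)
        have hreal : (FirstOrder.Language.Term.func (L := lang F) f ts).realize
            (fun n => v (termCode ν (.var n : Tm F ℕ))) =
              Model.app (T := T) (n := n) f fun k => v (termCode ν (ts k)) :=
          congrArg (Model.app (T := T) (n := n) f) ih'
        rw [hreal]
        by_cases hc : Fun.IsCons f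
        · have hcons : IsConsCode (termCode ν (FirstOrder.Language.Term.func (L := lang F) f ts)) :=
            ⟨h1, (headCode_termCode (ν := ν) f ts).trans ((Fun.code_eq_cons_iff f).2 hc)⟩
          rw [hv.cons_eq ht hcons, fstCode, sndCode, harg]
          cases f with
          | nil => exact hc.elim
          | other f => exact hc.elim
          | cons =>
            rw [Model.app_cons]
            rfl
        · have happ : IsAppCode (termCode ν (FirstOrder.Language.Term.func (L := lang F) f ts)) :=
            ⟨h1, fun e => hc ((Fun.code_eq_cons_iff (ν := ν) f).1
              ((headCode_termCode (ν := ν) f ts).symm.trans e))⟩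
          rw [hv.app_eq ht happ]
          unfold codeApp
          rw [hd]
    refine ⟨fun n => v (termCode ν (.var n : Tm F ℕ)), fun l hl => ?_⟩
    exact (l.realize_iff _ v fun t ht hs =>
      hval t (hside l hl t ht) (hs.trans (hlit l hl))).2 (hvl _ (List.mem_map_of_mem hl))

end Codes

/-! Tables of numbers, written as one number. -/

/-- Every sequence of digits with finite support is the expansion of a number. -/
theorem exists_digits (b L : ℕ) (f : ℕ → ℕ) (hf : ∀ n, f n < b) (hL : ∀ n, L ≤ n → f n = 0) :
    ∃ w < b ^ L, ∀ n, w / b ^ n % b = f n := by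
  induction L generalizing f with
  | zero =>
    refine ⟨0, by simp, fun n => ?_⟩
    rw [hL n (Nat.zero_le n)]
    simp
  | succ L ih =>
    obtain ⟨w, hw, h⟩ := ih (fun n => f (n + 1)) (fun n => hf _) fun n hn => hL _ (by omega)
    have hb : 0 < b := (Nat.zero_le _).trans_lt (hf 0)
    have h0 := hf 0
    refine ⟨f 0 + b * w, ?_, fun n => ?_⟩
    · calc f 0 + b * w < b + b * w := by omega
        _ = b * (w + 1) := by ring
        _ ≤ b * b ^ L := Nat.mul_le_mul_left _ hw
        _ = b ^ (L + 1) := by ring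
    · cases n with
      | zero => simp [Nat.mod_eq_of_lt h0]
      | succ n =>
        rw [pow_succ', ← Nat.div_div_eq_div_mul, Nat.add_mul_div_left _ _ hb,
          Nat.div_eq_of_lt h0, zero_add]
        exact h n

/-- The entry with indices `i`, `j` of the table `k` coded by `w`. -/
def entry (c : List ℕ) (w k i j : ℕ) : ℕ :=
  w / (Encodable.encode c + 1) ^ Nat.pair k (Nat.pair i j) % (Encodable.encode c + 1)

def row (c : List ℕ) (w k i : ℕ) : ℕ := entry c w k i 0

/-- The explicit bound makes every quantifier over the domain a bounded one. -/
def InDom (c : List ℕ) (w i : ℕ) : Prop := i < Encodable.encode c ∧ row c w 0 i = 1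

def EntryNe (c : List ℕ) (w k i j : ℕ) : Prop := entry c w k i j ≠ 0

/-- Writing `e` for the code of `c`, digits are used only at positions `pair k (pair i j)` with `k <
5`, `i < e`, `j ≤ e`. By monotonicity of `Nat.pair` these lie below the exponent. -/
def tableBound (c : List ℕ) : ℕ :=
  (Encodable.encode c + 1) ^ Nat.pair 5 (Nat.pair (Encodable.encode c) (Encodable.encode c + 1))

/-- A function of two arguments that can be coded as one of the tables for `c`. -/
def IsTable (c : List ℕ) (f : ℕ → ℕ → ℕ) : Prop :=
  ∀ i j, f i j ≤ Encodable.encode c ∧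
    (f i j ≠ 0 → i < Encodable.encode c ∧ j ≤ Encodable.encode c)

theorem isTable_unary {c : List ℕ} {g : ℕ → ℕ} (h : ∀ i, g i ≤ Encodable.encode c)
    (h' : ∀ i, ¬ SubCode c i → g i = 0) : IsTable c fun i j => if j = 0 then g i else 0 := by
  intro i j
  beta_reduce
  split_ifs with hj
  · refine ⟨h i, fun h0 => ⟨?_, by omega⟩⟩
    by_contra hi
    exact h0 (h' i fun hs => hi hs.lt)
  · exact ⟨Nat.zero_le _, fun h0 => (h0 rfl).elim⟩

theorem isTable_binary {c : List ℕ} {g : ℕ → ℕ → ℕ} (h : ∀ i j, g i j ≤ Encodable.encode c)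
    (h' : ∀ i j, ¬ (SubCode c i ∧ SubCode c j) → g i j = 0) : IsTable c g := by
  refine fun i j => ⟨h i j, fun h0 => ?_⟩
  have := not_imp_comm.1 (h' i j) h0
  exact ⟨this.1.lt, this.2.lt.le⟩

open Classical in
theorem isTable_rel {c : List ℕ} {R : ℕ → ℕ → Prop}
    (h : ∀ i j, R i j → SubCode c i ∧ SubCode c j) :
    IsTable c fun i j => if R i j then 1 else 0 := by
  refine isTable_binary (fun i j => ?_) fun i j hn => if_neg fun hR => hn (h i j hR)
  split_ifs with hR
  · have := (h i j hR).1.lt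
    omega
  · exact Nat.zero_le _

theorem exists_table (c : List ℕ) (l : List (ℕ → ℕ → ℕ)) (hl : ∀ f ∈ l, IsTable c f)
    (hlen : l.length ≤ 5) :
    ∃ w < tableBound c, ∀ k f, l[k]? = some f → entry c w k = f := by
  have h : ∀ k i j, (l[k]?.getD fun _ _ => 0) i j ≤ Encodable.encode c ∧
      ((l[k]?.getD fun _ _ => 0) i j ≠ 0 →
        k < 5 ∧ i < Encodable.encode c ∧ j ≤ Encodable.encode c) := by
    intro k i j
    cases hk : l[k]? with
    | none => simp
    | some f =>
      obtain ⟨hk', rfl⟩ := List.getElem?_eq_some_iff.1 hk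
      have := hl _ (List.getElem_mem hk') i j
      exact ⟨this.1, fun h0 => ⟨by omega, this.2 h0⟩⟩
  obtain ⟨w, hw, hw'⟩ := exists_digits (Encodable.encode c + 1)
    (Nat.pair 5 (Nat.pair (Encodable.encode c) (Encodable.encode c + 1)))
    (fun n => (l[n.unpair.1]?.getD fun _ _ => 0) n.unpair.2.unpair.1 n.unpair.2.unpair.2)
    (fun n => Nat.lt_succ_of_le (h _ _ _).1) fun n hn => by
      by_contra h0
      obtain ⟨h₁, h₂, h₃⟩ := (h _ _ _).2 h0
      have h₄ := (Nat.pair_lt_pair_left n.unpair.2.unpair.2 h₂).trans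
        (Nat.pair_lt_pair_right (Encodable.encode c) (Nat.lt_succ_of_le h₃))
      rw [Nat.pair_unpair] at h₄
      have h₅ := (Nat.pair_lt_pair_left n.unpair.2 h₁).trans (Nat.pair_lt_pair_right 5 h₄)
      rw [Nat.pair_unpair] at h₅
      exact absurd hn (not_le.2 h₅)
  refine ⟨w, hw, fun k f hk => ?_⟩
  funext i j
  rw [entry, hw']
  simp [hk]

/-- The decision procedure for the theories with permutativity. -/
def CommSat (abs : Prop) (c : List ℕ) : Prop :=
  ∃ w < tableBound c, SubPattern c (Encodable.encode c) (InDom c w) ∧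
    CommPattern abs (InDom c w) (row c w 1) (row c w 2) (row c w 3) (entry c w 4) ∧
    ∀ l ∈ c, LitHolds (fun i j => row c w 1 i = row c w 1 j)
      (fun i j => EntryNe c w 4 (row c w 1 i) (row c w 1 j)) l

/-- The decision procedure for the theories without permutativity. -/
def ChainSat (abs : Prop) (c : List ℕ) : Prop :=
  ∃ w < tableBound c, SubPattern c (Encodable.encode c) (InDom c w) ∧
    ChainPattern abs (InDom c w) (row c w 1) (row c w 2) (EntryNe c w 3) (EntryNe c w 4) ∧
    ∀ l ∈ c, LitHolds (fun i j => row c w 1 i = row c w 1 j)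
      (fun i j => EntryNe c w 3 (row c w 1 i) (row c w 1 j)) l

/-! ### Correctness of the bounded search. -/

section Correct

variable {T : Kind} {F : ℕ → Type u} {ν : ∀ n, F n → ℕ} {C : Constraint F}

theorem inDom_eq_subCode {c : List ℕ} {w : ℕ}
    (h : SubPattern c (Encodable.encode c) (InDom c w)) : InDom c w = SubCode c := by
  funext i
  refine propext ⟨fun hi => (h.iff_subCode le_rfl hi.1).1 hi, fun hi => ?_⟩
  exact (h.iff_subCode le_rfl hi.lt).2 hi

theorem commSat_iff (hT : T.Permutative) (hν : C.Naming ν) :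
    CommSat T.Absorptive (C.code ν) ↔ C.Satisfiable T := by
  classical
  obtain ⟨app, hI, hsat⟩ := exists_interp_satisfiable_iff T hν
  rw [hsat]
  set c := C.code ν with hc
  constructor
  · rintro ⟨w, -, hsub, hP, hl⟩
    rw [inDom_eq_subCode hsub] at hP
    obtain ⟨v, hv, h₁, h₂⟩ := hP.sound hT hI
    refine ⟨v, hv, fun l hlc => (LitHolds.congr (h₁ _ _ (.left hlc) (.right hlc)) ?_).2 (hl l hlc)⟩
    exact h₂ _ _ (.left hlc) (.right hlc)
  · rintro ⟨v, hv, hl⟩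
    obtain ⟨cl, rk, K, cnt, hP, hle, hzero, hcle, hczero, h₁, h₂⟩ :=
      CommPattern.complete hT hI hv
    -- Functions of one argument occupy column `0` of their table.
    obtain ⟨w, hw, he⟩ := exists_table c
      [fun i j => if j = 0 then (if SubCode c i then 1 else 0) else 0,
        fun i j => if j = 0 then cl i else 0, fun i j => if j = 0 then rk i else 0,
        fun i j => if j = 0 then K i else 0, cnt] (by
        simp only [List.forall_mem_cons, List.not_mem_nil, false_imp_iff, implies_true, and_true]
        exact ⟨isTable_unary
          (fun i => by
            split_ifs with h
            · have := h.lt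
              omega
            · exact Nat.zero_le _) (fun i h => if_neg h),
          isTable_unary (fun i => (hle i).1) fun i hi => (hzero i hi).1,
          isTable_unary (fun i => (hle i).2.1) fun i hi => (hzero i hi).2.1,
          isTable_unary (fun i => (hle i).2.2) fun i hi => (hzero i hi).2.2,
          isTable_binary hcle hczero⟩) le_rfl
    have e₁ : row c w 1 = cl := by
      funext i
      rw [row, he 1 _ rfl]
      exact if_pos rfl
    have e₂ : row c w 2 = rk := by
      funext i
      rw [row, he 2 _ rfl]
      exact if_pos rfl
    have e₃ : row c w 3 = K := by
      funext i
      rw [row, he 3 _ rfl]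
      exact if_pos rfl
    have e₄ : entry c w 4 = cnt := he 4 _ rfl
    have e₀ : InDom c w = SubCode c := by
      funext i
      rw [InDom, row, he 0 _ rfl]
      simp only [if_true, ite_eq_left_iff, zero_ne_one, imp_false, not_not, eq_iff_iff]
      exact ⟨fun h => h.2, fun h => ⟨h.lt, h⟩⟩
    refine ⟨w, hw, ?_, ?_, fun l hlc => ?_⟩
    · rw [e₀]
      exact subPattern_subCode le_rfl
    · rwa [e₀, e₁, e₂, e₃, e₄]
    · simp only [EntryNe, e₁, e₄]
      refine (LitHolds.congr (h₁ _ _ (.left hlc) (.right hlc)) ?_).1 (hl l hlc)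
      exact h₂ _ _ (.left hlc) (.right hlc)

theorem chainSat_iff (hT : ¬ T.Permutative) (hν : C.Naming ν) :
    ChainSat T.Absorptive (C.code ν) ↔ C.Satisfiable T := by
  classical
  obtain ⟨app, hI, hsat⟩ := exists_interp_satisfiable_iff T hν
  rw [hsat]
  set c := C.code ν with hc
  constructor
  · rintro ⟨w, -, hsub, hP, hl⟩
    rw [inDom_eq_subCode hsub] at hP
    obtain ⟨v, hv, h₁, h₂⟩ := hP.sound hT hI
    refine ⟨v, hv, fun l hlc => (LitHolds.congr (h₁ _ _ (.left hlc) (.right hlc)) ?_).2 (hl l hlc)⟩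
    exact h₂ _ _ (.left hlc) (.right hlc)
  · rintro ⟨v, hv, hl⟩
    obtain ⟨cl, rk, M, Col, hP, hle, hzero, hM, hCol, h₁, h₂⟩ :=
      ChainPattern.complete hT hI hv
    obtain ⟨w, hw, he⟩ := exists_table c
      [fun i j => if j = 0 then (if SubCode c i then 1 else 0) else 0,
        fun i j => if j = 0 then cl i else 0, fun i j => if j = 0 then rk i else 0,
        fun i j => if M i j then 1 else 0, fun i j => if Col i j then 1 else 0] (by
        simp only [List.forall_mem_cons, List.not_mem_nil, false_imp_iff, implies_true, and_true]
        exact ⟨isTable_unary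
          (fun i => by
            split_ifs with h
            · have := h.lt
              omega
            · exact Nat.zero_le _) (fun i h => if_neg h),
          isTable_unary (fun i => (hle i).1) fun i hi => (hzero i hi).1,
          isTable_unary (fun i => (hle i).2) fun i hi => (hzero i hi).2,
          isTable_rel hM, isTable_rel hCol⟩) le_rfl
    have e₁ : row c w 1 = cl := by
      funext i
      rw [row, he 1 _ rfl]
      exact if_pos rfl
    have e₂ : row c w 2 = rk := by
      funext i
      rw [row, he 2 _ rfl]
      exact if_pos rfl
    have e₃ : EntryNe c w 3 = M := by
      funext i j
      rw [EntryNe, he 3 _ rfl]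
      simp
    have e₄ : EntryNe c w 4 = Col := by
      funext i j
      rw [EntryNe, he 4 _ rfl]
      simp
    have e₀ : InDom c w = SubCode c := by
      funext i
      rw [InDom, row, he 0 _ rfl]
      simp only [if_true, ite_eq_left_iff, zero_ne_one, imp_false, not_not, eq_iff_iff]
      exact ⟨fun h => h.2, fun h => ⟨h.lt, h⟩⟩
    refine ⟨w, hw, ?_, ?_, fun l hlc => ?_⟩
    · rw [e₀]
      exact subPattern_subCode le_rfl
    · rwa [e₀, e₁, e₂, e₃, e₄]
    · simp only [e₁, e₃]
      refine (LitHolds.congr (h₁ _ _ (.left hlc) (.right hlc)) ?_).1 (hl l hlc)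
      exact h₂ _ _ (.left hlc) (.right hlc)

end Correct

/-! The decision procedures are primitive recursive. -/

section Primrec

variable {α : Type*} [Primcodable α]

theorem primrec_fst {β γ : Type*} [Primcodable β] [Primcodable γ] {f : α → β × γ}
    (hf : Primrec f) : Primrec fun a => (f a).1 := Primrec.fst.comp hf

theorem primrec_snd {β γ : Type*} [Primcodable β] [Primcodable γ] {f : α → β × γ}
    (hf : Primrec f) : Primrec fun a => (f a).2 := Primrec.snd.comp hf

theorem primrec_unpair {f : α → ℕ} (hf : Primrec f) : Primrec fun a => (f a).unpair :=
  Primrec.unpair.comp hf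

theorem primrec_headCode {f : α → ℕ} (hf : Primrec f) : Primrec fun a => headCode (f a) :=
  primrec_fst (primrec_unpair (primrec_snd (primrec_unpair hf)))

theorem primrec_argCodes {f : α → ℕ} (hf : Primrec f) : Primrec fun a => argCodes (f a) :=
  (Primrec.ofNat (List ℕ)).comp (primrec_snd (primrec_unpair (primrec_snd (primrec_unpair hf))))

theorem primrec_fstCode {f : α → ℕ} (hf : Primrec f) : Primrec fun a => fstCode (f a) :=
  (Primrec.list_getD 0).comp (primrec_argCodes hf) (Primrec.const 0)

theorem primrec_sndCode {f : α → ℕ} (hf : Primrec f) : Primrec fun a => sndCode (f a) :=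
  (Primrec.list_getD 0).comp (primrec_argCodes hf) (Primrec.const 1)

theorem primrec_leftCode {f : α → ℕ} (hf : Primrec f) : Primrec fun a => leftCode (f a) :=
  primrec_fst (primrec_unpair (primrec_snd (primrec_unpair hf)))

theorem primrec_rightCode {f : α → ℕ} (hf : Primrec f) : Primrec fun a => rightCode (f a) :=
  primrec_snd (primrec_unpair (primrec_snd (primrec_unpair hf)))

theorem primrec_encode {f : α → List ℕ} (hf : Primrec f) :
    Primrec fun a => Encodable.encode (f a) := Primrec.encode.comp hf

theorem primrec_add_one {f : α → ℕ} (hf : Primrec f) : Primrec fun a => f a + 1 :=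
  Primrec.succ.comp hf

theorem primrec_pow {f g : α → ℕ} (hf : Primrec f) (hg : Primrec g) :
    Primrec fun a => f a ^ g a :=
  (Primrec₂.unpaired'.1 Nat.Primrec.pow).comp hf hg

theorem primrec_natPair {f g : α → ℕ} (hf : Primrec f) (hg : Primrec g) :
    Primrec fun a => Nat.pair (f a) (g a) := Primrec₂.natPair.comp hf hg

theorem primrec_entry {c : α → List ℕ} {w k i j : α → ℕ} (hc : Primrec c) (hw : Primrec w)
    (hk : Primrec k) (hi : Primrec i) (hj : Primrec j) :
    Primrec fun a => entry (c a) (w a) (k a) (i a) (j a) := by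
  have hb := primrec_add_one (primrec_encode hc)
  exact Primrec.nat_mod.comp (Primrec.nat_div.comp hw
    (primrec_pow hb (primrec_natPair hk (primrec_natPair hi hj)))) hb

theorem primrec_row {c : α → List ℕ} {w k i : α → ℕ} (hc : Primrec c) (hw : Primrec w)
    (hk : Primrec k) (hi : Primrec i) : Primrec fun a => row (c a) (w a) (k a) (i a) :=
  primrec_entry hc hw hk hi (Primrec.const 0)

theorem primrec_map_row {c l : α → List ℕ} {w k : α → ℕ} (hc : Primrec c) (hw : Primrec w)
    (hk : Primrec k) (hl : Primrec l) : Primrec fun a => (l a).map (row (c a) (w a) (k a)) :=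
  Primrec.list_map hl (primrec_row (hc.comp Primrec.fst) (hw.comp Primrec.fst)
    (hk.comp Primrec.fst) Primrec.snd).to₂

theorem primrec_tableBound {c : α → List ℕ} (hc : Primrec c) :
    Primrec fun a => tableBound (c a) := by
  have h := primrec_encode hc
  exact primrec_pow (primrec_add_one h)
    (primrec_natPair (Primrec.const 5) (primrec_natPair h (primrec_add_one h)))

/-- Whether the theory is absorptive does not vary with the input, so its truth value is a constant
that need not be computed. -/
theorem primrecPred_const (p : Prop) : PrimrecPred fun _ : α => p := by
  classical
  exact ⟨fun _ => inferInstance, Primrec.const _⟩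

theorem primrecPred_and {p q : α → Prop} (hp : PrimrecPred p) (hq : PrimrecPred q) :
    PrimrecPred fun a => p a ∧ q a := hp.and hq

theorem primrecPred_or {p q : α → Prop} (hp : PrimrecPred p) (hq : PrimrecPred q) :
    PrimrecPred fun a => p a ∨ q a := hp.or hq

theorem primrecPred_not {p : α → Prop} (hp : PrimrecPred p) : PrimrecPred fun a => ¬ p a :=
  hp.not

theorem primrecPred_imp {p q : α → Prop} (hp : PrimrecPred p) (hq : PrimrecPred q) :
    PrimrecPred fun a => p a → q a := (hp.not.or hq).of_eq fun _ => imp_iff_not_or.symm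

theorem primrecPred_iff {p q : α → Prop} (hp : PrimrecPred p) (hq : PrimrecPred q) :
    PrimrecPred fun a => (p a ↔ q a) :=
  ((primrecPred_imp hp hq).and (primrecPred_imp hq hp)).of_eq fun _ => iff_iff_implies_and_implies.symm

theorem primrecPred_eq {β : Type*} [Primcodable β] {f g : α → β} (hf : Primrec f)
    (hg : Primrec g) : PrimrecPred fun a => f a = g a := by
  classical
  exact Primrec.eq.comp hf hg

theorem primrecPred_lt {f g : α → ℕ} (hf : Primrec f) (hg : Primrec g) :
    PrimrecPred fun a => f a < g a := Primrec.nat_lt.comp hf hg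

theorem primrecPred_le {f g : α → ℕ} (hf : Primrec f) (hg : Primrec g) :
    PrimrecPred fun a => f a ≤ g a := Primrec.nat_le.comp hf hg

theorem primrecPred_forall_mem {f : α → List ℕ} {R : α → ℕ → Prop} (hf : Primrec f)
    (hR : PrimrecPred fun p : α × ℕ => R p.1 p.2) : PrimrecPred fun a => ∀ x ∈ f a, R a x :=
  (PrimrecRel.forall_mem_list (R := fun x a => R a x)
    (hR.comp (Primrec.snd.pair Primrec.fst))).comp hf Primrec.id

theorem primrecPred_exists_mem {f : α → List ℕ} {R : α → ℕ → Prop} (hf : Primrec f)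
    (hR : PrimrecPred fun p : α × ℕ => R p.1 p.2) : PrimrecPred fun a => ∃ x ∈ f a, R a x :=
  (PrimrecRel.exists_mem_list (R := fun x a => R a x)
    (hR.comp (Primrec.snd.pair Primrec.fst))).comp hf Primrec.id

theorem primrecPred_forall_lt {f : α → ℕ} {R : α → ℕ → Prop} (hf : Primrec f)
    (hR : PrimrecPred fun p : α × ℕ => R p.1 p.2) : PrimrecPred fun a => ∀ x < f a, R a x :=
  (primrecPred_forall_mem (Primrec.list_range.comp hf) hR).of_eq fun _ => by
    simp only [List.mem_range]

theorem primrecPred_exists_lt {f : α → ℕ} {R : α → ℕ → Prop} (hf : Primrec f)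
    (hR : PrimrecPred fun p : α × ℕ => R p.1 p.2) : PrimrecPred fun a => ∃ x < f a, R a x :=
  (primrecPred_exists_mem (Primrec.list_range.comp hf) hR).of_eq fun _ => by
    simp only [List.mem_range]

theorem primrecPred_isAppCode {f : α → ℕ} (hf : Primrec f) :
    PrimrecPred fun a => IsAppCode (f a) :=
  primrecPred_and (primrecPred_eq (primrec_fst (primrec_unpair hf)) (Primrec.const 1))
    (primrecPred_not (primrecPred_eq (primrec_headCode hf) (Primrec.const _)))

theorem primrecPred_isConsCode {f : α → ℕ} (hf : Primrec f) :
    PrimrecPred fun a => IsConsCode (f a) :=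
  primrecPred_and (primrecPred_eq (primrec_fst (primrec_unpair hf)) (Primrec.const 1))
    (primrecPred_eq (primrec_headCode hf) (Primrec.const _))

theorem primrecPred_inDom {c : α → List ℕ} {w i : α → ℕ} (hc : Primrec c) (hw : Primrec w)
    (hi : Primrec i) : PrimrecPred fun a => InDom (c a) (w a) (i a) :=
  primrecPred_and (primrecPred_lt hi (primrec_encode hc))
    (primrecPred_eq (primrec_row hc hw (Primrec.const 0) hi) (Primrec.const 1))

theorem primrecPred_entryNe {c : α → List ℕ} {w k i j : α → ℕ} (hc : Primrec c) (hw : Primrec w)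
    (hk : Primrec k) (hi : Primrec i) (hj : Primrec j) :
    PrimrecPred fun a => EntryNe (c a) (w a) (k a) (i a) (j a) :=
  primrecPred_not (primrecPred_eq (primrec_entry hc hw hk hi hj) (Primrec.const 0))

theorem primrecPred_forall_inDom {c : α → List ℕ} {w : α → ℕ} {R : α → ℕ → Prop}
    (hc : Primrec c) (hw : Primrec w) (hR : PrimrecPred fun p : α × ℕ => R p.1 p.2) :
    PrimrecPred fun a => ∀ x, InDom (c a) (w a) x → R a x :=
  (primrecPred_forall_lt (primrec_encode hc) (R := fun a x => InDom (c a) (w a) x → R a x)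
    (primrecPred_imp (primrecPred_inDom (hc.comp Primrec.fst) (hw.comp Primrec.fst) Primrec.snd)
      hR)).of_eq fun _ => ⟨fun h x hx => h x hx.1 hx, fun h x _ hx => h x hx⟩

/-- As a conjunction of formulas with quantifiers guarded by `D` or by a list, the pattern is
accessible to the closure properties of primitive recursive predicates. -/
theorem commPattern_iff (abs : Prop) (D : ℕ → Prop) (cl rk K : ℕ → ℕ) (cnt : ℕ → ℕ → ℕ) :
    CommPattern abs D cl rk K cnt ↔
      (∀ i, D i → D (cl i) ∧ cl (cl i) = cl i) ∧
      (∀ i, D i → IsAppCode i → ∀ j, D j → IsAppCode j →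
        (cl i = cl j ↔ headCode i = headCode j ∧ (argCodes i).map cl = (argCodes j).map cl)) ∧
      (∀ i, D i → IsAppCode i → ∀ a ∈ argCodes i, ∀ j, D j → K (cl j) = K (cl i) →
        rk (cl a) < rk (cl j)) ∧
      (∀ i, D i → IsAppCode i → ∀ j, D j → IsAppCode j → K (cl i) = K (cl j) → cl i = cl j) ∧
      (∀ i, D i → IsAppCode i → ∀ c, D c → cnt (cl c) (cl i) = 0) ∧
      (∀ i, D i → IsConsCode i → K (cl i) = K (cl (sndCode i))) ∧
      (∀ i, D i → IsConsCode i → ∀ c, D c → ¬ cl c = cl (fstCode i) →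
        cnt (cl c) (cl i) = cnt (cl c) (cl (sndCode i))) ∧
      (¬ abs → ∀ i, D i → IsConsCode i → ∀ c, D c → cl c = cl (fstCode i) →
        cnt (cl c) (cl i) = cnt (cl c) (cl (sndCode i)) + 1) ∧
      (abs → ∀ i, D i → IsConsCode i → ∀ c, D c → cl c = cl (fstCode i) →
        cnt (cl c) (cl i) = 1) ∧
      (abs → ∀ c, D c → ∀ i, D i → cnt (cl c) (cl i) ≤ 1) ∧
      (∀ c, D c → ∀ i, D i → ¬ cnt (cl c) (cl i) = 0 → rk (cl c) < rk (cl i)) ∧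
      (∀ i, D i → ∀ j, D j → K (cl i) = K (cl j) →
        (∀ c, D c → cnt (cl c) (cl i) = cnt (cl c) (cl j)) → cl i = cl j) :=
  ⟨fun ⟨h₁, h₂, h₃, h₄, h₅, h₆, h₇, h₈, h₉, k₁, k₂, k₃⟩ =>
    ⟨h₁, h₂, h₃, h₄, h₅, h₆, h₇, h₈, h₉, k₁, k₂, k₃⟩,
  fun ⟨h₁, h₂, h₃, h₄, h₅, h₆, h₇, h₈, h₉, k₁, k₂, k₃⟩ =>
    ⟨h₁, h₂, h₃, h₄, h₅, h₆, h₇, h₈, h₉, k₁, k₂, k₃⟩⟩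

theorem chainPattern_iff (abs : Prop) (D : ℕ → Prop) (cl rk : ℕ → ℕ) (M Col : ℕ → ℕ → Prop) :
    ChainPattern abs D cl rk M Col ↔
      (∀ i, D i → D (cl i) ∧ cl (cl i) = cl i) ∧
      (∀ i, D i → IsAppCode i → ∀ j, D j → IsAppCode j →
        (cl i = cl j ↔ headCode i = headCode j ∧ (argCodes i).map cl = (argCodes j).map cl)) ∧
      (∀ i, D i → IsAppCode i → ∀ a ∈ argCodes i, rk (cl a) < rk (cl i)) ∧
      (∀ i, D i → IsAppCode i → ∀ c, D c → ¬ M (cl c) (cl i)) ∧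
      (∀ i, D i → IsAppCode i → ∀ j, D j → IsConsCode j → ¬ cl i = cl j) ∧
      (¬ abs → ∀ c, D c → ∀ i, D i → ¬ Col (cl c) (cl i)) ∧
      (∀ c, D c → ∀ i, D i → Col (cl c) (cl i) → M (cl c) (cl i)) ∧
      (∀ c, D c → ∀ d, D d → ∀ i, D i → Col (cl c) (cl i) → Col (cl d) (cl i) → cl c = cl d) ∧
      (∀ i, D i → IsConsCode i → Col (cl (fstCode i)) (cl (sndCode i)) →
        cl i = cl (sndCode i)) ∧
      (∀ i, D i → IsConsCode i → ¬ Col (cl (fstCode i)) (cl (sndCode i)) →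
        rk (cl (fstCode i)) < rk (cl i) ∧ rk (cl (sndCode i)) < rk (cl i)) ∧
      (∀ i, D i → IsConsCode i → ¬ Col (cl (fstCode i)) (cl (sndCode i)) →
        ∀ j, D j → IsConsCode j → ¬ Col (cl (fstCode j)) (cl (sndCode j)) →
          (cl i = cl j ↔ cl (fstCode i) = cl (fstCode j) ∧ cl (sndCode i) = cl (sndCode j))) ∧
      (∀ i, D i → IsConsCode i → ¬ Col (cl (fstCode i)) (cl (sndCode i)) → ∀ c, D c →
        (M (cl c) (cl i) ↔ cl c = cl (fstCode i) ∨ M (cl c) (cl (sndCode i)))) ∧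
      (abs → ∀ i, D i → IsConsCode i → ¬ Col (cl (fstCode i)) (cl (sndCode i)) →
        ∀ c, D c → (Col (cl c) (cl i) ↔ cl c = cl (fstCode i))) ∧
      (∀ c, D c → ∀ i, D i → M (cl c) (cl i) → rk (cl c) < rk (cl i)) :=
  ⟨fun ⟨h₁, h₂, h₃, h₄, h₅, h₆, h₇, h₈, h₉, k₁, k₂, k₃, k₄, k₅⟩ =>
    ⟨h₁, h₂, h₃, h₄, h₅, h₆, h₇, h₈, h₉, k₁, k₂, k₃, k₄, k₅⟩,
  fun ⟨h₁, h₂, h₃, h₄, h₅, h₆, h₇, h₈, h₉, k₁, k₂, k₃, k₄, k₅⟩ =>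
    ⟨h₁, h₂, h₃, h₄, h₅, h₆, h₇, h₈, h₉, k₁, k₂, k₃, k₄, k₅⟩⟩

theorem primrecPred_subPattern {c : α → List ℕ} {w : α → ℕ} (hc : Primrec c) (hw : Primrec w) :
    PrimrecPred fun a => SubPattern (c a) (Encodable.encode (c a)) (InDom (c a) (w a)) := by
  unfold SubPattern
  have hc' := hc.comp (Primrec.fst (α := α) (β := ℕ))
  have hw' := hw.comp (Primrec.fst (α := α) (β := ℕ))
  refine primrecPred_forall_lt (primrec_encode hc)
    (primrecPred_iff (primrecPred_inDom hc' hw' Primrec.snd) (primrecPred_or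
      (primrecPred_exists_mem hc' (primrecPred_or
        (primrecPred_eq (primrec_leftCode Primrec.snd) (primrec_snd Primrec.fst))
        (primrecPred_eq (primrec_rightCode Primrec.snd) (primrec_snd Primrec.fst))))
      (primrecPred_exists_lt (primrec_encode hc') (primrecPred_and
        (primrecPred_inDom (hc'.comp Primrec.fst) (hw'.comp Primrec.fst) Primrec.snd)
        (primrecPred_and (primrecPred_eq (primrec_fst (primrec_unpair Primrec.snd))
          (Primrec.const 1))
        (primrecPred_exists_mem (primrec_argCodes Primrec.snd)
          (primrecPred_eq Primrec.snd (primrec_snd (primrec_fst Primrec.fst)))))))))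

theorem primrecPred_commSat (abs : Prop) : PrimrecPred (CommSat abs) := by
  unfold CommSat
  simp only [commPattern_iff]
  refine primrecPred_exists_lt (primrec_tableBound Primrec.id)
    (primrecPred_and (primrecPred_subPattern Primrec.fst Primrec.snd) ?_)
  unfold LitHolds
  -- The closure lemmas follow the shape of the formula. At reducible transparency definitions such
  -- as `InDom` stay folded and are met by their own lemmas.
  repeat' with_reducible first
    | exact Primrec.const _
    | exact primrecPred_const _
    | exact Primrec.id
    | exact Primrec.fst
    | exact Primrec.snd
    | apply primrecPred_forall_inDom
    | apply primrecPred_forall_mem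
    | apply primrecPred_inDom
    | apply primrecPred_isAppCode
    | apply primrecPred_isConsCode
    | apply primrecPred_entryNe
    | apply primrecPred_and
    | apply primrecPred_or
    | apply primrecPred_not
    | apply primrecPred_iff
    | apply primrecPred_eq
    | apply primrecPred_lt
    | apply primrecPred_le
    | apply primrecPred_imp
    | apply primrec_row
    | apply primrec_entry
    | apply primrec_map_row
    | apply primrec_argCodes
    | apply primrec_headCode
    | apply primrec_fstCode
    | apply primrec_sndCode
    | apply primrec_leftCode
    | apply primrec_rightCode
    | apply primrec_add_one
    | apply primrec_unpair
    | apply primrec_fst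
    | apply primrec_snd

theorem primrecPred_chainSat (abs : Prop) : PrimrecPred (ChainSat abs) := by
  unfold ChainSat
  simp only [chainPattern_iff]
  refine primrecPred_exists_lt (primrec_tableBound Primrec.id)
    (primrecPred_and (primrecPred_subPattern Primrec.fst Primrec.snd) ?_)
  unfold LitHolds
  repeat' with_reducible first
    | exact Primrec.const _
    | exact primrecPred_const _
    | exact Primrec.id
    | exact Primrec.fst
    | exact Primrec.snd
    | apply primrecPred_forall_inDom
    | apply primrecPred_forall_mem
    | apply primrecPred_inDom
    | apply primrecPred_isAppCode
    | apply primrecPred_isConsCode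
    | apply primrecPred_entryNe
    | apply primrecPred_and
    | apply primrecPred_or
    | apply primrecPred_not
    | apply primrecPred_iff
    | apply primrecPred_eq
    | apply primrecPred_lt
    | apply primrecPred_le
    | apply primrecPred_imp
    | apply primrec_row
    | apply primrec_map_row
    | apply primrec_argCodes
    | apply primrec_headCode
    | apply primrec_fstCode
    | apply primrec_sndCode
    | apply primrec_leftCode
    | apply primrec_rightCode
    | apply primrec_unpair
    | apply primrec_fst
    | apply primrec_snd

end Primrec

end Aggregates

theorem corollary1 (T : Aggregates.Kind) :
    ∃ P : List ℕ → Prop, ComputablePred P ∧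
      ∀ (F : ℕ → Type u) (ν : ∀ n, F n → ℕ) (C : Aggregates.Constraint F),
        Aggregates.Constraint.Naming ν C →
          (P (Aggregates.Constraint.code ν C) ↔
            Aggregates.Constraint.Satisfiable T C) := by
  -- The case distinction concerns the theory alone, so the predicate is fixed before `F`, `ν` and
  -- `C` are given.
  by_cases hT : T.Permutative
  · exact ⟨Aggregates.CommSat T.Absorptive,
      (Aggregates.primrecPred_commSat _).computablePred,
      fun F ν C hν => Aggregates.commSat_iff hT hν⟩
  · exact ⟨Aggregates.ChainSat T.Absorptive,
      (Aggregates.primrecPred_chainSat _).computablePred,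
      fun F ν C hν => Aggregates.chainSat_iff hT hν⟩
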